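/- Let $H,G$ be real Hilbert spaces, $M:H\to G$ a bounded linear operator, $f:H\to\mathbb R$ convex and differentiable with $L_f$-Lipschitz gradient ($L_f\ge 0$), and $g:H\to(-\infty,+\infty]$, $h:G\to(-\infty,+\infty]$ proper, lower semicontinuous and convex. Put $F(x)=f(x)+g(x)+h(Mx)$, $F^\star=\inf_H F$, and let $\mathcal P^\star$ be the set of minimizers of $F$. Let $S$ be a bounded self-adjoint operator on $G$ with $\langle y,Sy\rangle\ge s\|y\|^2$ for all $y$ and some $s>0$; put $\|y\|_S=\sqrt{\langle y,Sy\rangle}$, $\|y\|_{S^{-1}}=\sqrt{\langle y,S^{-1}y\rangle}$ and $\|M\|_{S^{-1}}=\sup_{x\ne0}\|Mx\|_{S^{-1}}/\|x\|$. Let $\dot y\in G$. For $\beta>0$ let $$h_\beta(y;\dot y)=\max_{z\in G}\Big\{\langle y,z\rangle-h^*(z)-\tfrac{\beta}{2}\|z-\dot y\|_S^2\Big\},$$ where $h^*$ is the Fenchel conjugate of $h$, let $y_\beta^*(y;\dot y)$ be the point where this maximum is attained, and let $F_\beta(x)=f(x)+g(x)+h_\beta(Mx;\dot y)$. For $\gamma>0$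 let $\mathrm{prox}_{\gamma g}(x)=\mathrm{argmin}_z\{\gamma g(z)+\frac12\|z-x\|^2\}$. In each of the following algorithms $\tau_0=1$, $\beta_0>0$, the points $\bar x^0,\tilde x^0\in H$ are arbitrary, and for $k=0,1,2,\dots$ $$\hat x^k=(1-\tau_k)\bar x^k+\tau_k\tilde x^k,\qquad \beta_{k+1}=\frac{\beta_k}{1+\tau_k},\qquad v^k=M^*y^*_{\beta_{k+1}}(M\hat x^k;\dot y),$$ $$\tilde x^{k+1}=\mathrm{prox}_{\frac1{\tau_kB_{k+1}}g}\Big(\tilde x^k-\tfrac1{\tau_kB_{k+1}}(d^k+v^k)\Big),\qquad \bar x^{k+1}=(1-\tau_k)\bar x^k+\tau_k\tilde x^{k+1}.$$ 1. Linearized ASGARD (assuming $L_f>0$ or $M\neq0$): $d^k=\nabla f(\hat x^k)$, $B_{k+1}=L_f+\|M\|_{S^{-1}}^2/\beta_{k+1}$, and $\tau_{k+1}$ is the unique positive root $t$ of $\frac{B_{k+1}-L_f}{B_{k+1}}t^3+t^2+\tau_k^2t-\tau_k^2=0$. 2. Linearized ASGARD with old gradients (assuming $L_f>0$): $B_{k+1}$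 and $\tau_{k+1}$ as in 1; further inputs are $\delta>0$, $\sigma>0$ and an arbitrary first reference point in $H$. In iteration $k$ one first computes $\tilde x^{k+1},\bar x^{k+1}$ with $d^k=\nabla f(r)$, where $r$ is the current reference point. If $\frac12\|\bar x^{k+1}-r\|^2-\frac12\|\bar x^{k+1}-\hat x^k\|^2\le\sigma\big(\tau_k^2B_{k+1}/L_f\big)^{2+\delta}$, these points are accepted and $r$ is kept for the next iteration; otherwise the reference point becomes $\hat x^k$, and $\tilde x^{k+1},\bar x^{k+1}$ are recomputed with $d^k=\nabla f(\hat x^k)$. 3. Linearized ASGARD with line search: $d^k=\nabla f(\hat x^k)$; further inputs are $a>1$ and $0<B_0\le a\big(L_f+\|M\|_{S^{-1}}^2/\beta_0\big)$. In iteration $k$ the values $B_{k+1}=B_k,aB_k,a^2B_k,\dots$ are tried in turn; for each of them $\tau_k$ is $1$ if $k=0$ and otherwise the unique positive solution of $\frac{1-\tau_k}{\tau_k^2B_{k+1}}=\frac1{\tau_{k-1}^2B_k}$, and $\hat x^k,\beta_{k+1},v^k,\tilde x^{k+1},\bar x^{k+1}$ are computed from it as above. The first value is accepted for which $$f(\bar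 x^{k+1})+h_{\beta_{k+1}}(M\bar x^{k+1};\dot y)\le f(\hat x^k)+h_{\beta_{k+1}}(M\hat x^k;\dot y)+\langle\nabla f(\hat x^k)+v^k,\bar x^{k+1}-\hat x^k\rangle+\tfrac{B_{k+1}}2\|\bar x^{k+1}-\hat x^k\|^2 .$$ Then for every $x^\star\in\mathcal P^\star$ and every $k\in\mathbb N=\{0,1,2,\dots\}$, $$F_{\beta_{k+1}}(\bar x^{k+1})-F^\star\le\begin{cases}\dfrac{B_1}{2(k+1)}\|x^\star-\tilde x^0\|^2&\text{for Algorithm 1},\\[2mm]\dfrac{B_1}{k+1}\Big(\dfrac12\|x^\star-\tilde x^0\|^2+\sigma\Big(\dfrac{B_1}{L_f}\Big)^{1+\delta}\zeta(1+\delta)\Big)&\text{for Algorithm 2},\\[2mm]\dfrac{B_1\beta_{k+1}}{\beta_0}\|x^\star-\tilde x^0\|^2&\text{for Algorithm 3},\end{cases}$$ where $\zeta(s)=\sum_{i=0}^\infty(i+1)^{-s}$. Moreover, for Algorithm 3 there is a constant $C$ that depends only on $f,g,h,M,L_f,S,\dot y,a,\beta_0$ such that $\frac{B_1\beta_{k+1}}{\beta_0}\|x^\star-\tilde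 x^0\|^2\le\frac{C}{k+1}\|x^\star-\tilde x^0\|^2$ for every run, every $x^\star\in\mathcal P^\star$ and every $k\in\mathbb N$. -/

import Mathlib

noncomputable section

namespace Asgard

/-- Properness of an extended-real-valued function with values in `(-∞, +∞]`. -/
def IsProper {E : Type*} (φ : E → EReal) : Prop :=
  (∀ x, φ x ≠ ⊥) ∧ ∃ x, φ x ≠ ⊤

/-- Convexity of a function with values in `(-∞, +∞]`. -/
def IsConvex {E : Type*} [AddCommGroup E] [Module ℝ E] (φ : E → EReal) : Prop :=
  ∀ x y : E, ∀ s t : ℝ, 0 < s → 0 < t → s + t = 1 →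
    φ (s • x + t • y) ≤ (s : EReal) * φ x + (t : EReal) * φ y

/-- `f` is differentiable and its gradient is `L`-Lipschitz, in the form of the quadratic upper
bound (equivalent to Lipschitz continuity of the gradient for convex `f`). -/
def HasLipschitzGradient {E : Type*} [NormedAddCommGroup E] [InnerProductSpace ℝ E]
    [CompleteSpace E] (f : E → ℝ) (L : ℝ) : Prop :=
  Differentiable ℝ f ∧
    ∀ x y : E, f x ≤ f y + inner ℝ (x - y) (gradient f y) + L / 2 * ‖x - y‖ ^ 2

/-- Positive definite (self-adjoint, coercive) operators. -/
def IsPositiveDefinite {E : Type*} [NormedAddCommGroup E] [InnerProductSpace ℝ E]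
    [CompleteSpace E] (S : E →L[ℝ] E) : Prop :=
  IsSelfAdjoint S ∧ ∃ σ : ℝ, 0 < σ ∧ ∀ y : E, σ * ‖y‖ ^ 2 ≤ inner ℝ y (S y)

/-- The norm `‖y‖_S = √⟨y, S y⟩`. -/
def weightedNorm {E : Type*} [NormedAddCommGroup E] [InnerProductSpace ℝ E]
    (S : E →L[ℝ] E) (y : E) : ℝ :=
  Real.sqrt (inner ℝ y (S y))

/-- `p = prox_φ (x)`: the point `p` minimizes `z ↦ φ z + ‖z - x‖² / 2`. -/
def IsProx {E : Type*} [NormedAddCommGroup E] (φ : E → EReal) (x p : E) : Prop :=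
  IsMinOn (fun z => φ z + ((1 / 2 * ‖z - x‖ ^ 2 : ℝ) : EReal)) Set.univ p

/-- The Fenchel-Moreau conjugate. -/
def conjugate {E : Type*} [NormedAddCommGroup E] [InnerProductSpace ℝ E]
    (h : E → EReal) (y : E) : EReal :=
  ⨆ z : E, ((inner ℝ z y : ℝ) : EReal) - h z

/-- The objective `z ↦ ⟨y, z⟩ - h^*(z) - (β / 2) ‖z - ẏ‖_S²` of the problem that defines the
smooth approximation of `h`. -/
def smoothObjective {E : Type*} [NormedAddCommGroup E] [InnerProductSpace ℝ E]
    (h : E → EReal) (S : E →L[ℝ] E) (ydot : E) (β : ℝ) (y z : E) : EReal :=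
  ((inner ℝ y z : ℝ) : EReal) - conjugate h z - ((β / 2 * weightedNorm S (z - ydot) ^ 2 : ℝ) : EReal)

/-- The `β`-smooth approximation `h_β(y; ẏ)` of `h`. -/
def smoothApprox {E : Type*} [NormedAddCommGroup E] [InnerProductSpace ℝ E]
    (h : E → EReal) (S : E →L[ℝ] E) (ydot : E) (β : ℝ) (y : E) : EReal :=
  ⨆ z : E, smoothObjective h S ydot β y z

/-- `z = y_β^*(y; ẏ)`: the point `z` attains the maximum that defines `h_β(y; ẏ)`. -/
def IsSmoothArgmax {E : Type*} [NormedAddCommGroup E] [InnerProductSpace ℝ E]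
    (h : E → EReal) (S : E →L[ℝ] E) (ydot : E) (β : ℝ) (y z : E) : Prop :=
  IsMaxOn (smoothObjective h S ydot β y) Set.univ z

/-- The data and standing assumptions of the problem `min_x f(x) + g(x) + h(Mx)`. -/
structure Problem (H G : Type*) [NormedAddCommGroup H] [InnerProductSpace ℝ H] [CompleteSpace H]
    [NormedAddCommGroup G] [InnerProductSpace ℝ G] [CompleteSpace G] where
  f : H → ℝ
  g : H → EReal
  h : G → EReal
  M : H →L[ℝ] G
  Lf : ℝ
  Lf_nonneg : 0 ≤ Lf
  f_convex : ConvexOn ℝ Set.univ f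
  f_gradient : HasLipschitzGradient f Lf
  g_proper : IsProper g
  g_convex : IsConvex g
  g_lsc : LowerSemicontinuous g
  h_proper : IsProper h
  h_convex : IsConvex h
  h_lsc : LowerSemicontinuous h

section Algorithms

variable {H G : Type*} [NormedAddCommGroup H] [InnerProductSpace ℝ H] [CompleteSpace H]
  [NormedAddCommGroup G] [InnerProductSpace ℝ G] [CompleteSpace G]

/-- The objective function `F = f + g + h ∘ M`. -/
def Problem.F (P : Problem H G) (x : H) : EReal :=
  (P.f x : EReal) + P.g x + P.h (P.M x)

/-- The optimal value `F^⋆`. -/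
def Problem.optVal (P : Problem H G) : EReal :=
  ⨅ x : H, P.F x

/-- The set of minimizers of `F`. -/
def Problem.minimizers (P : Problem H G) : Set H :=
  {x | IsMinOn P.F Set.univ x}

/-- The smoothed objective `F_β = f + g + h_β(M ·; ẏ)`. -/
def Problem.smoothF (P : Problem H G) (S : G →L[ℝ] G) (ydot : G) (β : ℝ) (x : H) : EReal :=
  (P.f x : EReal) + P.g x + smoothApprox P.h S ydot β (P.M x)

/-- The operator norm `‖M‖_{S⁻¹} = sup_{x ≠ 0} ‖M x‖_{S⁻¹} / ‖x‖`. -/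
def Problem.normM (P : Problem H G) (S : G →L[ℝ] G) : ℝ :=
  ⨆ x : {x : H // x ≠ 0}, weightedNorm (ContinuousLinearMap.inverse S) (P.M x) / ‖(x : H)‖

/-- The proximal gradient step `p = prox_{γ g} (u - γ d)`. -/
def Problem.IsProxStep (P : Problem H G) (γ : ℝ) (u d p : H) : Prop :=
  IsProx (fun z => (γ : EReal) * P.g z) (u - γ • d) p

/-- `τ'` is the positive root of `((B - L_f) / B) t³ + t² + τ² t - τ² = 0`. -/
def Problem.IsNextTau (P : Problem H G) (B τ τ' : ℝ) : Prop :=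
  0 < τ' ∧ (B - P.Lf) / B * τ' ^ 3 + τ' ^ 2 + τ ^ 2 * τ' - τ ^ 2 = 0

/-- The sequences are generated by the linearized ASGARD algorithm; `y k` is the point
`y_{β_{k+1}}^*(M x̂^k; ẏ)`, and `B 0` is not used. -/
structure IsLinearized (P : Problem H G) (S : G →L[ℝ] G) (ydot : G)
    (τ β B : ℕ → ℝ) (xbar xtilde xhat : ℕ → H) (y : ℕ → G) : Prop where
  tau_zero : τ 0 = 1
  beta_zero : 0 < β 0
  hat : ∀ k, xhat k = (1 - τ k) • xbar k + τ k • xtilde k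
  beta_succ : ∀ k, β (k + 1) = β k / (1 + τ k)
  B_succ : ∀ k, B (k + 1) = P.Lf + P.normM S ^ 2 / β (k + 1)
  dual : ∀ k, IsSmoothArgmax P.h S ydot (β (k + 1)) (P.M (xhat k)) (y k)
  tilde_succ : ∀ k, P.IsProxStep (1 / (τ k * B (k + 1))) (xtilde k)
    (gradient P.f (xhat k) + ContinuousLinearMap.adjoint P.M (y k)) (xtilde (k + 1))
  bar_succ : ∀ k, xbar (k + 1) = (1 - τ k) • xbar k + τ k • xtilde (k + 1)
  tau_succ : ∀ k, P.IsNextTau (B (k + 1)) (τ k) (τ (k + 1))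

/-- The acceptance test for old gradients: `xold` is the point where the gradient of `f` was
taken, `xbar'` is the resulting candidate for the next main iterate. -/
def Problem.OldGradientTest (P : Problem H G) (σ δ τ B : ℝ) (xhat xold xbar' : H) : Prop :=
  1 / 2 * ‖xbar' - xold‖ ^ 2 - 1 / 2 * ‖xbar' - xhat‖ ^ 2 ≤ σ * (τ ^ 2 * B / P.Lf) ^ (2 + δ)

/-- The sequences are generated by the linearized ASGARD algorithm with old gradients.
`xold k` is the gradient reference point stored when iteration `k` starts (`xold 0` is an input)
and `xtrial k` is the proximal point computed from it in iteration `k`. If the corresponding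
candidate passes the test, it is accepted and the reference point is kept; otherwise the reference
point becomes `xhat k` and the proximal step is recomputed with the gradient of `f` at `xhat k`. -/
structure IsOldGradient (P : Problem H G) (S : G →L[ℝ] G) (ydot : G) (σ δ : ℝ)
    (τ β B : ℕ → ℝ) (xbar xtilde xhat xold xtrial : ℕ → H) (y : ℕ → G) : Prop where
  tau_zero : τ 0 = 1
  beta_zero : 0 < β 0
  hat : ∀ k, xhat k = (1 - τ k) • xbar k + τ k • xtilde k
  beta_succ : ∀ k, β (k + 1) = β k / (1 + τ k)
  B_succ : ∀ k, B (k + 1) = P.Lf + P.normM S ^ 2 / β (k + 1)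
  dual : ∀ k, IsSmoothArgmax P.h S ydot (β (k + 1)) (P.M (xhat k)) (y k)
  trial : ∀ k, P.IsProxStep (1 / (τ k * B (k + 1))) (xtilde k)
    (gradient P.f (xold k) + ContinuousLinearMap.adjoint P.M (y k)) (xtrial k)
  accept : ∀ k,
    P.OldGradientTest σ δ (τ k) (B (k + 1)) (xhat k) (xold k)
        ((1 - τ k) • xbar k + τ k • xtrial k) →
      xold (k + 1) = xold k ∧ xtilde (k + 1) = xtrial k
  reject : ∀ k,
    ¬ P.OldGradientTest σ δ (τ k) (B (k + 1)) (xhat k) (xold k)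
        ((1 - τ k) • xbar k + τ k • xtrial k) →
      xold (k + 1) = xhat k ∧
        P.IsProxStep (1 / (τ k * B (k + 1))) (xtilde k)
          (gradient P.f (xhat k) + ContinuousLinearMap.adjoint P.M (y k)) (xtilde (k + 1))
  bar_succ : ∀ k, xbar (k + 1) = (1 - τ k) • xbar k + τ k • xtilde (k + 1)
  tau_succ : ∀ k, P.IsNextTau (B (k + 1)) (τ k) (τ (k + 1))

/-- The quantities computed in one pass through the line search loop. -/
structure Trial (H G : Type*) where
  B : ℝ
  τ : ℝ
  β : ℝ
  xhat : H
  y : G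
  xtilde : H
  xbar : H

/-- The trial `t` is what one pass of the line search loop computes with the estimate `t.B`, from
the current values `β`, `xbar`, `xtilde`; the requirement on the step parameter is `tauRule`. -/
structure Trial.IsComputed (t : Trial H G) (P : Problem H G) (S : G →L[ℝ] G) (ydot : G)
    (tauRule : ℝ → ℝ → Prop) (β : ℝ) (xbar xtilde : H) : Prop where
  tau : tauRule t.B t.τ
  hat : t.xhat = (1 - t.τ) • xbar + t.τ • xtilde
  beta : t.β = β / (1 + t.τ)
  dual : IsSmoothArgmax P.h S ydot t.β (P.M t.xhat) t.y
  tilde : P.IsProxStep (1 / (t.τ * t.B)) xtilde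
    (gradient P.f t.xhat + ContinuousLinearMap.adjoint P.M t.y) t.xtilde
  bar : t.xbar = (1 - t.τ) • xbar + t.τ • t.xtilde

/-- The stopping test of the line search. -/
def Trial.Passes (t : Trial H G) (P : Problem H G) (S : G →L[ℝ] G) (ydot : G) : Prop :=
  (P.f t.xbar : EReal) + smoothApprox P.h S ydot t.β (P.M t.xbar) ≤
    (P.f t.xhat : EReal) + smoothApprox P.h S ydot t.β (P.M t.xhat) +
      ((inner ℝ (gradient P.f t.xhat + ContinuousLinearMap.adjoint P.M t.y) (t.xbar - t.xhat) +
        t.B / 2 * ‖t.xbar - t.xhat‖ ^ 2 : ℝ) : EReal)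

/-- The rule for `τ_k` in iteration `k` of the line search variant: `τ_0 = 1`, and for `k ≥ 1`,
`τ_k` is the positive solution of `(1 - τ_k) / (τ_k² B_{k+1}) = 1 / (τ_{k-1}² B_k)`. -/
def lineSearchTau (τ B : ℕ → ℝ) : ℕ → ℝ → ℝ → Prop
  | 0, _, t => t = 1
  | k + 1, B', t => 0 < t ∧ (1 - t) / (t ^ 2 * B') = 1 / (τ k ^ 2 * B (k + 1))

/-- The sequences are generated by the linearized ASGARD algorithm with line search: in iteration
`k` the estimates `B_k, a B_k, a² B_k, …` are tried, and the first one that passes the test is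
accepted. -/
structure IsLineSearch (P : Problem H G) (S : G →L[ℝ] G) (ydot : G) (a : ℝ)
    (τ β B : ℕ → ℝ) (xbar xtilde xhat : ℕ → H) (y : ℕ → G) : Prop where
  one_lt_a : 1 < a
  beta_zero : 0 < β 0
  B_zero_pos : 0 < B 0
  B_zero_le : B 0 ≤ a * (P.Lf + P.normM S ^ 2 / β 0)
  step : ∀ k, ∃ n : ℕ,
    B (k + 1) = a ^ n * B k ∧
    (∀ m < n, ∃ t : Trial H G, t.B = a ^ m * B k ∧
      t.IsComputed P S ydot (lineSearchTau τ B k) (β k) (xbar k) (xtilde k) ∧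
      ¬ t.Passes P S ydot) ∧
    (⟨B (k + 1), τ k, β (k + 1), xhat k, y k, xtilde (k + 1), xbar (k + 1)⟩ :
      Trial H G).IsComputed P S ydot (lineSearchTau τ B k) (β k) (xbar k) (xtilde k) ∧
    (⟨B (k + 1), τ k, β (k + 1), xhat k, y k, xtilde (k + 1), xbar (k + 1)⟩ :
      Trial H G).Passes P S ydot

end Algorithms

end Asgard

end

/-! All three rates come from one inequality for the weights `c k = τ k ^ 2 * B (k + 1)`. Smoothing
makes `h_β` differentiable with a Lipschitz gradient, so the linearization at `x̂` bounds `f + h_β ∘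
M` at the new point up to a quadratic. The linear model of `h_β` is built from a single dual point
`y`. At `x̄` it is bounded by `h_{β(1+τ)}` (test the supremum at `y`), and at `x⋆` by `h`
(Fenchel-Young). The penalty terms match because `(1 - τ)(1 + τ) = 1 - τ² ≤ 1`, which is why `β` is
divided by `1 + τ`. With the three-point inequality of the proximal step this gives
`Problem.descent_step`.

The rule for `τ` makes `c (k + 1) = (1 - τ (k + 1)) * c k`, so the inequality divided by `c k`
telescopes (`accelerated_recursion`), and the gap is at most `c k * ‖x⋆ - x̃⁰‖² / 2` plus
accumulated errors. What remains is to bound `c k`: by `B 1 / (k + 1)` for the cubic rule, and by a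
multiple of `β (k + 1)` for the line search. There `τ k` is bounded below by a multiple of `β (k +
1)`, so `1 / β k` grows linearly. -/

namespace Asgard

/-! ### First-order conditions and the norms of `S` and its inverse. -/

section

variable {H G : Type*} [NormedAddCommGroup H] [InnerProductSpace ℝ H] [CompleteSpace H]
  [NormedAddCommGroup G] [InnerProductSpace ℝ G] [CompleteSpace G]

/-- The first-order lower bound for a differentiable convex function. -/
theorem gradient_inequality {f : H → ℝ} (hf : ConvexOn ℝ Set.univ f) (hd : Differentiable ℝ f)
    (x y : H) : f y + inner ℝ (x - y) (gradient f y) ≤ f x := by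
  have h1 : HasDerivAt (fun t : ℝ => f (y + t • (x - y))) (inner ℝ (gradient f y) (x - y)) 0 := by
    have hg : HasFDerivAt f (InnerProductSpace.toDual ℝ H (gradient f y)) (y + (0 : ℝ) • (x - y)) := by
      simpa using (hd y).hasGradientAt.hasFDerivAt
    have hl : HasDerivAt (fun t : ℝ => y + t • (x - y)) (x - y) 0 := by
      simpa using ((hasDerivAt_id (0 : ℝ)).smul_const (x - y)).const_add y
    exact hg.comp_hasDerivAt (0 : ℝ) hl
  have h2 : ConvexOn ℝ Set.univ (fun t : ℝ => f (y + t • (x - y))) := by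
    have := hf.comp_affineMap (AffineMap.lineMap y x : ℝ →ᵃ[ℝ] H)
    refine this.congr fun t _ => ?_
    simp [AffineMap.lineMap_apply, add_comm]
  have h3 := h2.le_slope_of_hasDerivAt (Set.mem_univ 0) (Set.mem_univ 1) zero_lt_one h1
  simp only [slope, sub_zero, inv_one, one_smul, zero_smul, add_zero, vsub_eq_sub] at h3
  rw [real_inner_comm] at h3
  have : y + (x - y) = x := by abel
  rw [this] at h3
  linarith

/-- Divide by `t` and let `t → 0`. This extracts first-order optimality along segments, both for the
dual maximizer and for the proximal point. -/
theorem le_zero_of_forall_mul_le_sq {A K : ℝ}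
    (h : ∀ t : ℝ, 0 < t → t < 1 → t * A ≤ t ^ 2 * K) : A ≤ 0 := by
  by_contra! hA
  have hK : 0 < |K| + A := by positivity
  have ht : 0 < A / (2 * (|K| + A)) := by positivity
  have ht1 : A / (2 * (|K| + A)) < 1 := by
    rw [div_lt_one (by positivity)]
    nlinarith [abs_nonneg K]
  have h1 := h _ ht ht1
  rw [pow_two, mul_assoc] at h1
  have h2 := le_of_mul_le_mul_left h1 ht
  have h3 : A / (2 * (|K| + A)) * K ≤ A / (2 * (|K| + A)) * (|K| + A) :=
    mul_le_mul_of_nonneg_left (by linarith [le_abs_self K]) ht.le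
  have h4 : A / (2 * (|K| + A)) * (|K| + A) = A / 2 := by field_simp
  linarith

namespace IsPositiveDefinite

variable {S : G →L[ℝ] G}

theorem inner_comm (hS : IsPositiveDefinite S) (x y : G) : inner ℝ x (S y) = inner ℝ y (S x) := by
  have h := hS.1.isSymmetric x y
  simp only [ContinuousLinearMap.coe_coe] at h
  rw [← h, real_inner_comm]

theorem inner_self_nonneg (hS : IsPositiveDefinite S) (y : G) : 0 ≤ inner ℝ y (S y) := by
  obtain ⟨c, hc, h⟩ := hS.2
  exact le_trans (by positivity) (h y)

theorem weightedNorm_sq (hS : IsPositiveDefinite S) (y : G) :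
    weightedNorm S y ^ 2 = inner ℝ y (S y) :=
  Real.sq_sqrt (hS.inner_self_nonneg y)

/-- `ContinuousLinearMap.inverse` is zero on maps without inverse; coercivity ensures that it is the
true inverse here. -/
theorem isInvertible (hS : IsPositiveDefinite S) : S.IsInvertible := by
  obtain ⟨c, hc, h⟩ := hS.2
  have : IsUnit S := by
    refine ContinuousLinearMap.isUnit_of_forall_le_norm_inner_map (𝕜 := ℝ) S (c := ⟨c, hc.le⟩) hc
      fun x => ?_
    have h1 := h x
    rw [real_inner_comm] at h1
    have := le_trans h1 (le_abs_self _)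
    rw [Real.norm_eq_abs, mul_comm]
    exact this
  obtain ⟨u, hu⟩ := this
  exact ⟨ContinuousLinearEquiv.unitsEquiv ℝ G u, by ext x; simp [← hu]⟩

theorem apply_inverse (hS : IsPositiveDefinite S) (y : G) :
    S (ContinuousLinearMap.inverse S y) = y :=
  hS.isInvertible.self_apply_inverse y

theorem inner_inverse (hS : IsPositiveDefinite S) (y : G) :
    inner ℝ y (ContinuousLinearMap.inverse S y) =
      inner ℝ (ContinuousLinearMap.inverse S y) (S (ContinuousLinearMap.inverse S y)) := by
  rw [hS.apply_inverse, real_inner_comm]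

theorem inner_inverse_nonneg (hS : IsPositiveDefinite S) (y : G) :
    0 ≤ inner ℝ y (ContinuousLinearMap.inverse S y) := by
  rw [hS.inner_inverse]
  exact hS.inner_self_nonneg _

theorem inner_inverse_pos (hS : IsPositiveDefinite S) {y : G} (hy : y ≠ 0) :
    0 < inner ℝ y (ContinuousLinearMap.inverse S y) := by
  rw [hS.inner_inverse]
  obtain ⟨c, hc, h⟩ := hS.2
  refine lt_of_lt_of_le ?_ (h _)
  have : ContinuousLinearMap.inverse S y ≠ 0 := fun h0 => hy (by
    rw [← hS.apply_inverse y, h0, map_zero])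
  positivity

theorem inner_add_smul (hS : IsPositiveDefinite S) (x y : G) (t : ℝ) :
    inner ℝ (x + t • y) (S (x + t • y)) =
      inner ℝ x (S x) + 2 * t * inner ℝ y (S x) + t ^ 2 * inner ℝ y (S y) := by
  simp only [map_add, map_smul, inner_add_left, inner_add_right, real_inner_smul_left,
    real_inner_smul_right, hS.inner_comm x y]
  ring

/-- Young's inequality for the dual norms `‖·‖_S` and `‖·‖_{S⁻¹}`. -/
theorem inner_le (hS : IsPositiveDefinite S) {β : ℝ} (hβ : 0 < β) (u w : G) :
    inner ℝ u w - β / 2 * inner ℝ w (S w) ≤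
      1 / (2 * β) * inner ℝ u (ContinuousLinearMap.inverse S u) := by
  -- Expand the squared `S`-norm of `S⁻¹u - βw` and divide by `2β`.
  have h := hS.inner_self_nonneg (ContinuousLinearMap.inverse S u + (-β) • w)
  rw [hS.inner_add_smul, ← hS.inner_inverse, hS.apply_inverse, real_inner_comm u w] at h
  have h2 : 1 / (2 * β) * inner ℝ u (ContinuousLinearMap.inverse S u)
      - (inner ℝ u w - β / 2 * inner ℝ w (S w)) = 1 / (2 * β) *
      (inner ℝ u (ContinuousLinearMap.inverse S u) + 2 * -β * inner ℝ u w
        + (-β) ^ 2 * inner ℝ w (S w)) := by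
    field_simp
    ring
  have h3 : 0 < 1 / (2 * β) := by positivity
  have := mul_nonneg h3.le h
  linarith

theorem weightedNorm_inverse_sq (hS : IsPositiveDefinite S) (y : G) :
    weightedNorm (ContinuousLinearMap.inverse S) y ^ 2 =
      inner ℝ y (ContinuousLinearMap.inverse S y) :=
  Real.sq_sqrt (hS.inner_inverse_nonneg y)

end IsPositiveDefinite

/-- A real supremum over an unbounded set would be the default value `0`, so boundedness has to
precede any use of `normM` as an operator norm. -/
theorem Problem.bddAbove_normM (P : Problem H G) (S : G →L[ℝ] G) :
    BddAbove (Set.range fun x : {x : H // x ≠ 0} =>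
      weightedNorm (ContinuousLinearMap.inverse S) (P.M x) / ‖(x : H)‖) := by
  refine ⟨Real.sqrt (‖P.M‖ ^ 2 * ‖ContinuousLinearMap.inverse S‖), ?_⟩
  rintro _ ⟨⟨x, hx⟩, rfl⟩
  have hx' : 0 < ‖x‖ := norm_pos_iff.2 hx
  simp only
  rw [div_le_iff₀ hx', weightedNorm]
  refine Real.sqrt_le_iff.2 ⟨by positivity, ?_⟩
  rw [mul_pow, Real.sq_sqrt (by positivity)]
  calc inner ℝ (P.M x) (ContinuousLinearMap.inverse S (P.M x))
      ≤ ‖P.M x‖ * ‖ContinuousLinearMap.inverse S (P.M x)‖ := real_inner_le_norm _ _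
    _ ≤ ‖P.M x‖ * (‖ContinuousLinearMap.inverse S‖ * ‖P.M x‖) := by
        gcongr; exact ContinuousLinearMap.le_opNorm _ _
    _ = ‖ContinuousLinearMap.inverse S‖ * ‖P.M x‖ ^ 2 := by ring
    _ ≤ ‖ContinuousLinearMap.inverse S‖ * (‖P.M‖ * ‖x‖) ^ 2 := by
        gcongr; exact ContinuousLinearMap.le_opNorm _ _
    _ = ‖P.M‖ ^ 2 * ‖ContinuousLinearMap.inverse S‖ * ‖x‖ ^ 2 := by ring

theorem Problem.inner_inverse_le (P : Problem H G) {S : G →L[ℝ] G} (hS : IsPositiveDefinite S)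
    (x : H) : inner ℝ (P.M x) (ContinuousLinearMap.inverse S (P.M x)) ≤
      P.normM S ^ 2 * ‖x‖ ^ 2 := by
  by_cases hx : x = 0
  · simp [hx]
  have hx' : 0 < ‖x‖ := norm_pos_iff.2 hx
  have h := le_ciSup (P.bddAbove_normM S) ⟨x, hx⟩
  simp only at h
  rw [div_le_iff₀ hx'] at h
  rw [← hS.weightedNorm_inverse_sq, ← mul_pow]
  exact pow_le_pow_left₀ (Real.sqrt_nonneg _) h 2

theorem Problem.normM_pos (P : Problem H G) {S : G →L[ℝ] G} (hS : IsPositiveDefinite S)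
    (hM : P.M ≠ 0) : 0 < P.normM S ^ 2 := by
  obtain ⟨x, hx⟩ : ∃ x, P.M x ≠ 0 := by
    by_contra! h
    exact hM (ContinuousLinearMap.ext h)
  have h1 := (hS.inner_inverse_pos hx).trans_le (P.inner_inverse_le hS x)
  exact pos_of_mul_pos_left h1 (by positivity)

end

end Asgard

namespace Asgard

/-! ### The smooth approximation through the conjugate. -/

section Conjugate

variable {G : Type*} [NormedAddCommGroup G] [InnerProductSpace ℝ G] {h : G → EReal}

theorem conjugate_ne_bot (hh : IsProper h) (z : G) : conjugate h z ≠ ⊥ := by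
  obtain ⟨y, hy⟩ := hh.2
  intro hbot
  have h1 := le_iSup (fun y : G => ((inner ℝ y z : ℝ) : EReal) - h y) y
  change _ ≤ conjugate h z at h1
  rw [hbot] at h1
  lift h y to ℝ using ⟨hy, hh.1 y⟩ with r
  simp only [← EReal.coe_sub, le_bot_iff, EReal.coe_ne_bot] at h1

/-- The Fenchel-Young inequality. -/
theorem inner_sub_le_of_conjugate_eq {z : G} {q : ℝ} (hq : conjugate h z = q) (u : G) :
    ((inner ℝ u z - q : ℝ) : EReal) ≤ h u := by
  have h1 := le_iSup (fun y : G => ((inner ℝ y z : ℝ) : EReal) - h y) u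
  change _ ≤ conjugate h z at h1
  rw [hq] at h1
  induction hu : h u with
  | bot => simp [hu] at h1
  | top => simp
  | coe r =>
    simp only [hu] at h1
    norm_cast at h1 ⊢
    linarith

theorem conjugate_segment_le {z z' : G} {q q' : ℝ} (hq : conjugate h z = q)
    (hq' : conjugate h z' = q') {t : ℝ} (ht0 : 0 < t) (ht1 : t < 1) :
    conjugate h (z + t • (z' - z)) ≤ (((1 - t) * q + t * q' : ℝ) : EReal) := by
  refine iSup_le fun u => ?_
  have h1 := inner_sub_le_of_conjugate_eq hq u
  have h2 := inner_sub_le_of_conjugate_eq hq' u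
  induction hu : h u with
  | bot => rw [hu] at h1; simp only [le_bot_iff, EReal.coe_ne_bot] at h1
  | top => simp
  | coe r =>
    rw [hu] at h1 h2
    norm_cast at h1 h2 ⊢
    simp only [inner_add_right, real_inner_smul_right, inner_sub_right]
    nlinarith

variable {S : G →L[ℝ] G} {ydot : G} {β : ℝ}

/-- A conjugate that is `⊤` everywhere is not excluded by a Hahn-Banach argument; the claims are
trivial in that case, because the smoothed value is `⊥`. -/
theorem smoothApprox_eq_bot (hh : ∀ z, conjugate h z = ⊤) (u : G) :
    smoothApprox h S ydot β u = ⊥ := by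
  refine iSup_eq_bot.2 fun z => ?_
  simp [smoothObjective, hh z]

theorem IsSmoothArgmax.exists_conjugate_eq (hh : IsProper h) (hfin : ∃ z, conjugate h z ≠ ⊤)
    {v z : G} (hz : IsSmoothArgmax h S ydot β v z) : ∃ q : ℝ, conjugate h z = q := by
  obtain ⟨z₀, hz₀⟩ := hfin
  have h1 : smoothObjective h S ydot β v z₀ ≤ smoothObjective h S ydot β v z := hz (Set.mem_univ z₀)
  refine ⟨(conjugate h z).toReal, (EReal.coe_toReal (fun htop => ?_) (conjugate_ne_bot hh z)).symm⟩
  simp only [smoothObjective, htop] at h1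
  lift conjugate h z₀ to ℝ using ⟨hz₀, conjugate_ne_bot hh z₀⟩ with q₀
  simp only [← EReal.coe_sub, EReal.sub_top, EReal.bot_sub, le_bot_iff, EReal.coe_ne_bot] at h1

variable [CompleteSpace G]

theorem le_smoothApprox (hS : IsPositiveDefinite S) {z : G} {q : ℝ} (hq : conjugate h z = q)
    (u : G) : ((inner ℝ u z - q - β / 2 * inner ℝ (z - ydot) (S (z - ydot)) : ℝ) : EReal) ≤
      smoothApprox h S ydot β u := by
  refine le_trans (le_of_eq ?_) (le_iSup (smoothObjective h S ydot β u) z)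
  simp only [smoothObjective, hq, hS.weightedNorm_sq, EReal.coe_sub]

/-- Along the segment from `z` to `z'` the conjugate is convex and the penalty expands exactly, so
maximality yields the first-order condition `key`. The exact second-order term of the penalty is the
surplus. -/
theorem IsSmoothArgmax.strong_concavity (hS : IsPositiveDefinite S) {v z : G} {q : ℝ}
    (hz : IsSmoothArgmax h S ydot β v z) (hq : conjugate h z = q) {z' : G} {q' : ℝ}
    (hq' : conjugate h z' = q') :
    inner ℝ v z' - q' - β / 2 * inner ℝ (z' - ydot) (S (z' - ydot)) ≤
      inner ℝ v z - q - β / 2 * inner ℝ (z - ydot) (S (z - ydot))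
        - β / 2 * inner ℝ (z' - z) (S (z' - z)) := by
  have key : inner ℝ v (z' - z) - (q' - q) - β * inner ℝ (z' - z) (S (z - ydot)) ≤ 0 := by
    refine le_zero_of_forall_mul_le_sq (K := β / 2 * inner ℝ (z' - z) (S (z' - z)))
      fun t ht0 ht1 => ?_
    have h1 : smoothObjective h S ydot β v (z + t • (z' - z)) ≤ smoothObjective h S ydot β v z :=
      hz (Set.mem_univ _)
    have h2 : ((inner ℝ v (z + t • (z' - z)) : ℝ) : EReal)
        - (((1 - t) * q + t * q' : ℝ) : EReal)
        - ((β / 2 * weightedNorm S (z + t • (z' - z) - ydot) ^ 2 : ℝ) : EReal) ≤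
        smoothObjective h S ydot β v (z + t • (z' - z)) :=
      EReal.sub_le_sub (EReal.sub_le_sub le_rfl (conjugate_segment_le hq hq' ht0 ht1)) le_rfl
    have h3 := h2.trans h1
    simp only [smoothObjective, hq, hS.weightedNorm_sq] at h3
    norm_cast at h3
    rw [show z + t • (z' - z) - ydot = (z - ydot) + t • (z' - z) by abel, hS.inner_add_smul,
      inner_add_right, real_inner_smul_right] at h3
    nlinarith
  have h4 : z' - ydot = (z - ydot) + (1 : ℝ) • (z' - z) := by
    rw [one_smul]; abel
  rw [h4, hS.inner_add_smul]
  rw [inner_sub_right] at key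
  linarith

/-- The smoothness of the approximation `h_β`. -/
theorem IsSmoothArgmax.smoothApprox_le (hh : IsProper h) (hS : IsPositiveDefinite S) (hβ : 0 < β)
    {v z : G} {q : ℝ} (hz : IsSmoothArgmax h S ydot β v z) (hq : conjugate h z = q) (u : G) :
    smoothApprox h S ydot β u ≤
      ((inner ℝ u z - q - β / 2 * inner ℝ (z - ydot) (S (z - ydot))
        + 1 / (2 * β) * inner ℝ (u - v) (ContinuousLinearMap.inverse S (u - v)) : ℝ) : EReal) := by
  refine iSup_le fun z' => ?_
  by_cases htop : conjugate h z' = ⊤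
  · simp [smoothObjective, htop]
  have hq' : conjugate h z' = (conjugate h z').toReal :=
    (EReal.coe_toReal htop (conjugate_ne_bot hh z')).symm
  generalize (conjugate h z').toReal = q' at hq'
  have h1 := hz.strong_concavity hS hq hq'
  have h2 := hS.inner_le hβ (u - v) (z' - z)
  simp only [smoothObjective, hq', hS.weightedNorm_sq, ← EReal.coe_sub, EReal.coe_le_coe_iff]
  simp only [inner_sub_left u v, inner_sub_right _ z' z] at h2 h1 ⊢
  linarith

end Conjugate

/-! ### The proximal step. -/

section

variable {H G : Type*} [NormedAddCommGroup H] [InnerProductSpace ℝ H] [CompleteSpace H]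
  [NormedAddCommGroup G] [InnerProductSpace ℝ G] [CompleteSpace G]

/-- The three-point inequality for the proximal step. -/
theorem Problem.IsProxStep.exists_three_point {P : Problem H G} {γ : ℝ} (hγ : 0 < γ) {u d p : H}
    (hp : P.IsProxStep γ u d p) {x : H} {gx : ℝ} (hx : P.g x = gx) :
    ∃ gp : ℝ, P.g p = gp ∧
      γ * gp + γ * inner ℝ (p - x) d + 1 / 2 * ‖p - u‖ ^ 2 + 1 / 2 * ‖x - p‖ ^ 2 ≤
        γ * gx + 1 / 2 * ‖x - u‖ ^ 2 := by
  have hmin : ∀ z, (γ : EReal) * P.g p + ((1 / 2 * ‖p - (u - γ • d)‖ ^ 2 : ℝ) : EReal) ≤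
      (γ : EReal) * P.g z + ((1 / 2 * ‖z - (u - γ • d)‖ ^ 2 : ℝ) : EReal) :=
    fun z => hp (Set.mem_univ z)
  have htop : P.g p ≠ ⊤ := by
    intro htop
    have h1 := hmin x
    rw [hx, htop, EReal.coe_mul_top_of_pos hγ, EReal.top_add_coe, top_le_iff] at h1
    norm_cast at h1
    exact EReal.coe_ne_top _ h1
  have hg : P.g p = (P.g p).toReal := (EReal.coe_toReal htop (P.g_proper.1 p)).symm
  generalize (P.g p).toReal = gp at hg
  refine ⟨gp, hg, ?_⟩
  -- Variational inequality at `p`: compare `p` with `(1 - t) • p + t • x` for small `t`.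
  have key : γ * (gp - gx) + inner ℝ (p - x) (p - (u - γ • d)) ≤ 0 := by
    refine le_zero_of_forall_mul_le_sq (K := 1 / 2 * ‖x - p‖ ^ 2) fun t ht0 ht1 => ?_
    have h1 := P.g_convex p x (1 - t) t (by linarith) ht0 (by ring)
    have h2 := hmin ((1 - t) • p + t • x)
    have h3 := h2.trans (add_le_add_left (mul_le_mul_of_nonneg_left h1 (by exact_mod_cast hγ.le)) _)
    rw [hg, hx] at h3
    norm_cast at h3
    rw [show (1 - t) • p + t • x - (u - γ • d) = (p - (u - γ • d)) + t • (x - p) by module,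
      norm_add_sq_real, norm_smul, mul_pow, Real.norm_eq_abs, sq_abs, real_inner_smul_right,
      ← neg_sub p x, inner_neg_right, norm_neg, real_inner_comm] at h3
    rw [norm_sub_rev x p]
    linarith
  have e1 : ‖x - u‖ ^ 2 = ‖p - u‖ ^ 2 + 2 * inner ℝ (p - u) (x - p) + ‖x - p‖ ^ 2 := by
    rw [← norm_add_sq_real, show p - u + (x - p) = x - u by abel]
  have e2 : inner ℝ (p - x) (p - (u - γ • d)) =
      -inner ℝ (p - u) (x - p) + γ * inner ℝ (p - x) d := by
    rw [show p - (u - γ • d) = (p - u) + γ • d by abel, inner_add_right, real_inner_smul_right,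
      ← neg_sub x p, inner_neg_left, real_inner_comm, inner_neg_left]
  linarith

end

end Asgard

namespace Asgard

/-! ### One iteration, and summation over iterations. -/

section

variable {H G : Type*} [NormedAddCommGroup H] [InnerProductSpace ℝ H] [CompleteSpace H]
  [NormedAddCommGroup G] [InnerProductSpace ℝ G] [CompleteSpace G]
  {P : Problem H G} {S : G →L[ℝ] G} {ydot : G}

/-- One iteration of an accelerated proximal gradient method whose linearization at `xhat` is
`ε`-accurate, with the smoothness parameter decreasing from `β * (1 + τ)` to `β`. -/
theorem Problem.descent_step (hS : IsPositiveDefinite S)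
    {β τ B ε : ℝ} (hβ : 0 < β) (hτ : 0 < τ) (hτ1 : τ ≤ 1) (hB : 0 < B)
    {xbar xtilde xhat d p xbar' xstar : H} {y : G} {q gs hs Φ : ℝ}
    (hq : conjugate P.h y = q)
    (hhat : xhat = (1 - τ) • xbar + τ • xtilde)
    (hp : P.IsProxStep (1 / (τ * B)) xtilde (d + ContinuousLinearMap.adjoint P.M y) p)
    (hbar : xbar' = (1 - τ) • xbar + τ • p)
    (hgs : P.g xstar = gs) (hhs : P.h (P.M xstar) = hs)
    (hup : ∀ x, (P.f xbar' : EReal) + smoothApprox P.h S ydot β (P.M xbar') ≤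
      ((P.f x + inner ℝ d (xbar' - x) + (inner ℝ (P.M xbar') y - q
        - β / 2 * inner ℝ (y - ydot) (S (y - ydot))) + B / 2 * ‖xbar' - xhat‖ ^ 2 + ε : ℝ) : EReal))
    (hΦ : τ = 1 ∨ P.smoothF S ydot (β * (1 + τ)) xbar ≤ Φ) :
    P.smoothF S ydot β xbar' ≤
      (((1 - τ) * Φ + τ * (P.f xstar + gs + hs) +
        τ ^ 2 * B * (‖xstar - xtilde‖ ^ 2 - ‖xstar - p‖ ^ 2) / 2 + ε : ℝ) : EReal) := by
  have hτB : 0 < 1 / (τ * B) := by positivity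
  obtain ⟨gp, hgp, hthree⟩ := hp.exists_three_point hτB hgs
  set W := inner ℝ (y - ydot) (S (y - ydot)) with hW
  have hW0 : 0 ≤ W := hS.inner_self_nonneg _
  have hFY : inner ℝ (P.M xstar) y - q ≤ hs := by
    have := inner_sub_le_of_conjugate_eq hq (P.M xstar)
    rw [hhs] at this
    exact_mod_cast this
  obtain ⟨g', hg', hgΦ⟩ : ∃ g' : ℝ, P.g xbar' ≤ g' ∧
      g' + (1 - τ) * (P.f xbar + inner ℝ (P.M xbar) y - q - β * (1 + τ) / 2 * W) ≤
        (1 - τ) * Φ + τ * gp := by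
    -- For `τ = 1` the point `xbar` has weight zero, so its value may be `⊤`, as it can be for the
    -- arbitrary starting point. For `τ < 1` the real bound `Φ` forces `g xbar` to be finite.
    rcases hΦ with h1 | hΦ
    · refine ⟨gp, ?_, by rw [h1]; linarith⟩
      rw [hbar, h1]
      simp [hgp]
    rcases hτ1.eq_or_lt with h1 | hlt
    · refine ⟨gp, ?_, by rw [h1]; linarith⟩
      rw [hbar, h1]
      simp [hgp]
    have h2 := (add_le_add_right (le_smoothApprox (S := S) (ydot := ydot) (β := β * (1 + τ)) hS hq
      (P.M xbar)) ((P.f xbar : EReal) + P.g xbar)).trans hΦ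
    rw [← hW] at h2
    have htop : P.g xbar ≠ ⊤ := by
      intro htop
      rw [htop, EReal.coe_add_top, EReal.top_add_coe, top_le_iff] at h2
      exact EReal.coe_ne_top _ h2
    have hgb : P.g xbar = (P.g xbar).toReal := (EReal.coe_toReal htop (P.g_proper.1 _)).symm
    generalize (P.g xbar).toReal = gb at hgb
    rw [hgb] at h2
    norm_cast at h2
    refine ⟨(1 - τ) * gb + τ * gp, ?_, ?_⟩
    · have h3 := P.g_convex xbar p (1 - τ) τ (by linarith) hτ (by ring)
      rw [hgb, hgp, ← hbar] at h3
      exact_mod_cast h3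
    · nlinarith
  have hA : (P.f xbar' : EReal) + smoothApprox P.h S ydot β (P.M xbar') ≤
      (((1 - τ) * (P.f xbar + inner ℝ d (xbar' - xbar)) +
        τ * (P.f xstar + inner ℝ d (xbar' - xstar)) + (inner ℝ (P.M xbar') y - q
        - β / 2 * W) + B / 2 * ‖xbar' - xhat‖ ^ 2 + ε : ℝ) : EReal) := by
    have h1 := hup xbar
    have h2 := hup xstar
    -- A bound by each of two reals is a bound by their convex combination: the smaller one
    -- suffices, and no `EReal` value has to be scaled.
    rcases le_total (P.f xbar + inner ℝ d (xbar' - xbar)) (P.f xstar + inner ℝ d (xbar' - xstar))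
      with hle | hle
    · refine h1.trans (EReal.coe_le_coe_iff.2 ?_)
      nlinarith
    · refine h2.trans (EReal.coe_le_coe_iff.2 ?_)
      nlinarith
  have hsum : P.smoothF S ydot β xbar' = ((P.f xbar' : EReal) +
      smoothApprox P.h S ydot β (P.M xbar')) + P.g xbar' := by
    rw [Problem.smoothF, add_right_comm]
  rw [hsum]
  refine (add_le_add hA hg').trans ?_
  rw [← EReal.coe_add, EReal.coe_le_coe_iff]
  have e1 : xbar' - xhat = τ • (p - xtilde) := by rw [hbar, hhat]; module
  have e2 : ‖xbar' - xhat‖ ^ 2 = τ ^ 2 * ‖p - xtilde‖ ^ 2 := by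
    rw [e1, norm_smul, mul_pow, Real.norm_eq_abs, sq_abs]
  have e3 : inner ℝ d xbar' = (1 - τ) * inner ℝ d xbar + τ * inner ℝ d p := by
    rw [hbar, inner_add_right, real_inner_smul_right, real_inner_smul_right]
  have e4 : inner ℝ (P.M xbar') y = (1 - τ) * inner ℝ (P.M xbar) y + τ * inner ℝ (P.M p) y := by
    rw [hbar, map_add, map_smul, map_smul, inner_add_left, real_inner_smul_left,
      real_inner_smul_left]
  have e5 : inner ℝ (p - xstar) (d + ContinuousLinearMap.adjoint P.M y) =
      inner ℝ d p - inner ℝ d xstar + inner ℝ (P.M p) y - inner ℝ (P.M xstar) y := by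
    rw [inner_add_right, ContinuousLinearMap.adjoint_inner_right, map_sub, inner_sub_left,
      inner_sub_left, real_inner_comm d p, real_inner_comm d xstar]
    ring
  rw [e5] at hthree
  have h5 := mul_le_mul_of_nonneg_left hthree (show 0 ≤ τ ^ 2 * B by positivity)
  have e6 : ∀ a b c e : ℝ, τ ^ 2 * B * (1 / (τ * B) * a + 1 / (τ * B) * b + c + e) =
      τ * a + τ * b + τ ^ 2 * B * (c + e) := by
    intro a b c e; field_simp; ring
  have e7 : ∀ a c : ℝ, τ ^ 2 * B * (1 / (τ * B) * a + c) = τ * a + τ ^ 2 * B * c := by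
    intro a c; field_simp
  rw [e6, e7] at h5
  rw [inner_sub_right, inner_sub_right, e3, e4, e2]
  have h6 := mul_le_mul_of_nonneg_left hFY hτ.le
  -- The slack in the penalty terms: `β/2 - (1 - τ) * (β * (1 + τ) / 2) = τ² * β/2`.
  have h7 : 0 ≤ τ ^ 2 * (β / 2 * W) := by positivity
  nlinarith

/-- The quadratic upper bound for the smooth part, with the gradient of `f` taken at `r`. -/
theorem Problem.smooth_upper_bound (hS : IsPositiveDefinite S) {β ε : ℝ} (hβ : 0 < β)
    {xhat x' r : H} {y : G} {q : ℝ} (hq : conjugate P.h y = q)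
    (hy : IsSmoothArgmax P.h S ydot β (P.M xhat) y)
    (hε : P.Lf / 2 * ‖x' - r‖ ^ 2 - P.Lf / 2 * ‖x' - xhat‖ ^ 2 ≤ ε) (x : H) :
    (P.f x' : EReal) + smoothApprox P.h S ydot β (P.M x') ≤
      ((P.f x + inner ℝ (gradient P.f r) (x' - x) + (inner ℝ (P.M x') y - q
        - β / 2 * inner ℝ (y - ydot) (S (y - ydot))) +
        (P.Lf + P.normM S ^ 2 / β) / 2 * ‖x' - xhat‖ ^ 2 + ε : ℝ) : EReal) := by
  refine (add_le_add_right (hy.smoothApprox_le P.h_proper hS hβ hq (P.M x')) _).trans ?_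
  rw [← EReal.coe_add, EReal.coe_le_coe_iff, ← map_sub]
  -- Subtracting the convexity bound at `x` from the quadratic bound at `x'` cancels `f r`. The
  -- price of an old `r` is only `‖x' - r‖²` in place of `‖x' - xhat‖²`, which `ε` absorbs.
  have h1 := P.f_gradient.2 x' r
  have h2 := gradient_inequality P.f_convex P.f_gradient.1 x r
  have h3 := mul_le_mul_of_nonneg_left (P.inner_inverse_le hS (x' - xhat))
    (show 0 ≤ 1 / (2 * β) by positivity)
  have e1 : 1 / (2 * β) * (P.normM S ^ 2 * ‖x' - xhat‖ ^ 2) =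
      P.normM S ^ 2 / β / 2 * ‖x' - xhat‖ ^ 2 := by
    field_simp
  rw [e1] at h3
  have e2 : inner ℝ (gradient P.f r) (x' - x) =
      inner ℝ (x' - r) (gradient P.f r) - inner ℝ (x - r) (gradient P.f r) := by
    rw [← inner_sub_left, real_inner_comm, show x' - r - (x - r) = x' - x by abel]
  rw [e2]
  linarith

theorem Trial.Passes.upper_bound (hS : IsPositiveDefinite S) {t : Trial H G}
    (ht : t.Passes P S ydot) (hβ : 0 < t.β) {q : ℝ} (hq : conjugate P.h t.y = q)
    (hy : IsSmoothArgmax P.h S ydot t.β (P.M t.xhat) t.y) (x : H) :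
    (P.f t.xbar : EReal) + smoothApprox P.h S ydot t.β (P.M t.xbar) ≤
      ((P.f x + inner ℝ (gradient P.f t.xhat) (t.xbar - x) + (inner ℝ (P.M t.xbar) t.y - q
        - t.β / 2 * inner ℝ (t.y - ydot) (S (t.y - ydot))) +
        t.B / 2 * ‖t.xbar - t.xhat‖ ^ 2 + 0 : ℝ) : EReal) := by
  refine ht.trans ((add_le_add_left (add_le_add_right
    (hy.smoothApprox_le P.h_proper hS hβ hq (P.M t.xhat)) _) _).trans ?_)
  rw [← EReal.coe_add, ← EReal.coe_add, EReal.coe_le_coe_iff]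
  have h2 := gradient_inequality P.f_convex P.f_gradient.1 x t.xhat
  simp only [sub_self, inner_zero_left, inner_add_left, ContinuousLinearMap.adjoint_inner_left,
    inner_sub_right, map_sub, inner_sub_left, real_inner_comm (P.M _) t.y,
    real_inner_comm (gradient P.f t.xhat)] at h2 ⊢
  linarith

/-- Read contrapositively: a rejected estimate lies below the global Lipschitz constant at `t.β`,
which keeps the line search bounded. -/
theorem Trial.passes_of_le (hS : IsPositiveDefinite S) {t : Trial H G} (hβ : 0 < t.β)
    (hy : IsSmoothArgmax P.h S ydot t.β (P.M t.xhat) t.y)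
    (hB : P.Lf + P.normM S ^ 2 / t.β ≤ t.B) : t.Passes P S ydot := by
  by_cases hfin : ∃ z, conjugate P.h z ≠ ⊤
  · obtain ⟨q, hq⟩ := hy.exists_conjugate_eq P.h_proper hfin
    refine (P.smooth_upper_bound hS hβ hq hy (ε := 0) (r := t.xhat) (by simp) t.xhat).trans ?_
    refine le_trans ?_ (add_le_add_left (add_le_add_right
      (le_smoothApprox hS hq (P.M t.xhat)) _) _)
    rw [← EReal.coe_add, ← EReal.coe_add, EReal.coe_le_coe_iff]
    have h1 := mul_le_mul_of_nonneg_right hB (sq_nonneg ‖t.xbar - t.xhat‖)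
    simp only [inner_add_left, ContinuousLinearMap.adjoint_inner_left, map_sub, inner_sub_right,
      real_inner_comm (P.M _) t.y]
    linarith
  · push Not at hfin
    unfold Trial.Passes
    rw [smoothApprox_eq_bot hfin, EReal.add_bot]
    exact bot_le

/-- To bound the optimality gap, it suffices to do so when the conjugate of `h` is proper and the
optimal value is finite. -/
theorem Problem.smoothF_sub_optVal_le {xstar : H} (hx : xstar ∈ P.minimizers) {β R : ℝ} {x : H}
    (hR : (∃ z, conjugate P.h z ≠ ⊤) → ∀ gs hs : ℝ, P.g xstar = gs → P.h (P.M xstar) = hs →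
      P.smoothF S ydot β x ≤ ((P.f xstar + gs + hs + R : ℝ) : EReal)) :
    P.smoothF S ydot β x - P.optVal ≤ (R : EReal) := by
  have hopt : P.optVal = P.F xstar :=
    le_antisymm (iInf_le _ xstar) (le_iInf fun z => hx (Set.mem_univ z))
  rw [hopt]
  by_cases hfin : ∃ z, conjugate P.h z ≠ ⊤
  swap
  · push Not at hfin
    rw [Problem.smoothF, smoothApprox_eq_bot hfin, EReal.add_bot, EReal.bot_sub]
    exact bot_le
  -- If the optimal value is `⊤`, subtracting it gives `⊥` in `EReal`.
  by_cases hg : P.g xstar = ⊤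
  · simp [Problem.F, hg, EReal.top_add_of_ne_bot (P.h_proper.1 _)]
  by_cases hh : P.h (P.M xstar) = ⊤
  · have : (P.f xstar : EReal) + P.g xstar ≠ ⊥ :=
      EReal.add_ne_bot_iff.2 ⟨EReal.coe_ne_bot _, P.g_proper.1 _⟩
    simp [Problem.F, hh, EReal.add_top_of_ne_bot this]
  have hg' : P.g xstar = (P.g xstar).toReal := (EReal.coe_toReal hg (P.g_proper.1 _)).symm
  have hh' : P.h (P.M xstar) = (P.h (P.M xstar)).toReal :=
    (EReal.coe_toReal hh (P.h_proper.1 _)).symm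
  refine EReal.sub_le_of_le_add ((hR hfin _ _ hg' hh').trans (le_of_eq ?_))
  rw [Problem.F, hg', hh', EReal.toReal_coe, EReal.toReal_coe]
  norm_cast
  ring

end

/-- Summation of the descent inequalities of an accelerated method. -/
theorem accelerated_recursion {Ψ : ℕ → EReal} {τ c D ε : ℕ → ℝ} {Fs : ℝ} (h0 : τ 0 = 1)
    (hc : ∀ k, 0 < c k) (hrec : ∀ k, c (k + 1) = (1 - τ (k + 1)) * c k)
    (hstep : ∀ (k : ℕ) (Φ : ℝ), (τ k = 1 ∨ Ψ k ≤ Φ) →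
      Ψ (k + 1) ≤ (((1 - τ k) * Φ + τ k * Fs + c k * (D k - D (k + 1)) / 2 + ε k : ℝ) : EReal))
    (k : ℕ) : Ψ (k + 1) ≤ ((Fs + c k * (D 0 - D (k + 1)) / 2 +
      c k * ∑ i ∈ Finset.range (k + 1), ε i / c i : ℝ) : EReal) := by
  induction k with
  | zero =>
    -- The value `Φ = 0` is arbitrary: its coefficient `1 - τ 0` vanishes.
    refine (hstep 0 0 (Or.inl h0)).trans (EReal.coe_le_coe_iff.2 (le_of_eq ?_))
    have := (hc 0).ne'
    rw [h0, Finset.sum_range_one]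
    field_simp
    ring
  | succ k ih =>
    refine (hstep (k + 1) _ (Or.inr ih)).trans (EReal.coe_le_coe_iff.2 (le_of_eq ?_))
    have h1 : ε (k + 1) = c (k + 1) * (ε (k + 1) / c (k + 1)) := by
      have := (hc (k + 1)).ne'
      field_simp
    rw [Finset.sum_range_succ _ (k + 1)]
    nth_rewrite 1 [h1]
    have h2 := hrec k
    generalize ε (k + 1) / c (k + 1) = e
    rw [h2]
    ring

end Asgard

namespace Asgard

/-! ### Step parameters defined by the cubic equation. -/

section Parameters

variable {H G : Type*} [NormedAddCommGroup H] [InnerProductSpace ℝ H] [CompleteSpace H]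
  [NormedAddCommGroup G] [InnerProductSpace ℝ G] [CompleteSpace G]
  {P : Problem H G} {S : G →L[ℝ] G} {τ β B : ℕ → ℝ}

theorem Problem.IsNextTau.lt_one {b t t' : ℝ} (hb : 0 < b) (hLb : P.Lf ≤ b)
    (h : P.IsNextTau b t t') : t' < 1 := by
  obtain ⟨h0, h1⟩ := h
  have hρ : 0 ≤ (b - P.Lf) / b := div_nonneg (by linarith) hb.le
  by_contra! hge
  have h2 : 0 ≤ (b - P.Lf) / b * t' ^ 3 := by positivity
  nlinarith [sq_nonneg t, mul_nonneg (sq_nonneg t) (sub_nonneg.2 hge)]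

/-- The cubic coefficient is at most `1`, so `t² (1 - t') ≤ t'² (1 + t')`. If `t' < 1/(n+1)`, then
`n t' < 1 - t'`, and `1 - t' ≤ n² t'² (1 + t') ≤ n t' (1 - t'²) < 1 - t'` is absurd. -/
theorem Problem.IsNextTau.inv_le {b t t' : ℝ} (hb : 0 < b) (h : P.IsNextTau b t t') {n : ℝ}
    (hn : 0 < n) (ht : 1 / n ≤ t) : 1 / (n + 1) ≤ t' := by
  obtain ⟨h0, h1⟩ := h
  have hρ : (b - P.Lf) / b ≤ 1 := (div_le_one hb).2 (by linarith [P.Lf_nonneg])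
  have h2 : (b - P.Lf) / b * t' ^ 3 ≤ 1 * t' ^ 3 := by gcongr
  have h3 : t ^ 2 * (1 - t') ≤ t' ^ 2 * (1 + t') := by nlinarith
  by_contra! hlt
  have h4 : t' * (n + 1) < 1 := by rwa [lt_div_iff₀ (by linarith)] at hlt
  have h5 : t' < 1 := hlt.trans (by rw [div_lt_one (by linarith)]; linarith)
  have h6 : (1 / n) ^ 2 * (1 - t') ≤ t ^ 2 * (1 - t') := by
    have : 0 ≤ 1 - t' := by linarith
    gcongr
  have h7 : 1 - t' ≤ n ^ 2 * (t' ^ 2 * (1 + t')) := by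
    have h8 := h6.trans h3
    have h9 := mul_le_mul_of_nonneg_left h8 (sq_nonneg n)
    rwa [← mul_assoc, ← mul_pow, mul_one_div_cancel hn.ne', one_pow, one_mul] at h9
  have h8 : n * t' < 1 - t' := by linarith
  have h9 : (n * t') * (n * t') ≤ (n * t') * (1 - t') :=
    mul_le_mul_of_nonneg_left h8.le (by positivity)
  nlinarith [mul_le_mul_of_nonneg_right h9 (show 0 ≤ 1 + t' by linarith), mul_pos hn h0,
    mul_pos (mul_pos hn h0) (sq_pos_of_pos h0), sq_pos_of_pos h0]

variable (hτ0 : τ 0 = 1) (hβ0 : 0 < β 0) (hβ : ∀ k, β (k + 1) = β k / (1 + τ k))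
  (hB : ∀ k, B (k + 1) = P.Lf + P.normM S ^ 2 / β (k + 1))
  (hL : 0 < P.Lf ∨ 0 < P.normM S ^ 2)
  (hτ : ∀ k, P.IsNextTau (B (k + 1)) (τ k) (τ (k + 1)))

include hτ0 hτ in
theorem tau_pos (k : ℕ) : 0 < τ k := by
  cases k with
  | zero => rw [hτ0]; exact one_pos
  | succ k => exact (hτ k).1

include hβ0 hβ in
theorem beta_pos_of_tau_pos (hpos : ∀ k, 0 < τ k) (k : ℕ) : 0 < β k := by
  induction k with
  | zero => exact hβ0
  | succ k ih =>
    rw [hβ]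
    have := hpos k
    positivity

include hB hL in
theorem estimate_pos {k : ℕ} (hβk : 0 < β (k + 1)) : 0 < B (k + 1) ∧ P.Lf ≤ B (k + 1) := by
  rw [hB]
  have hLf := P.Lf_nonneg
  have h1 : 0 ≤ P.normM S ^ 2 / β (k + 1) := by positivity
  refine ⟨?_, by linarith⟩
  rcases hL with h | h
  · linarith
  · have : 0 < P.normM S ^ 2 / β (k + 1) := by positivity
    linarith

include hτ0 hβ0 hβ hB hL hτ in
theorem tau_mem (k : ℕ) : 1 / ((k : ℝ) + 1) ≤ τ k ∧ τ k ≤ 1 := by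
  have hβpos := beta_pos_of_tau_pos hβ0 hβ (tau_pos hτ0 hτ)
  induction k with
  | zero => simp [hτ0]
  | succ k ih =>
    obtain ⟨h1, h2⟩ := estimate_pos hB hL (hβpos (k + 1))
    refine ⟨?_, ((hτ k).lt_one h1 h2).le⟩
    push_cast
    exact (hτ k).inv_le h1 (by positivity) ih.1

include hτ0 hβ0 hβ hB hL hτ in
-- The cubic was designed for this: since `B (k+2) = B (k+1) + τ (k+1) * (B (k+1) - Lf)`, it is this
-- identity divided by `B (k+1)`.
theorem weight_succ (k : ℕ) :
    τ (k + 1) ^ 2 * B (k + 1 + 1) = (1 - τ (k + 1)) * (τ k ^ 2 * B (k + 1)) := by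
  have hβpos := beta_pos_of_tau_pos hβ0 hβ (tau_pos hτ0 hτ)
  obtain ⟨h1, -⟩ := estimate_pos hB hL (hβpos (k + 1))
  obtain ⟨h2, h3⟩ := hτ k
  have h4 : B (k + 1 + 1) = B (k + 1) + τ (k + 1) * (B (k + 1) - P.Lf) := by
    have := hβpos (k + 1)
    rw [hB (k + 1), hβ (k + 1), hB k]
    field_simp
    ring
  rw [h4]
  field_simp at h3
  linarith

include hτ0 hβ0 hβ hB hL hτ in
theorem weight_le (k : ℕ) : τ k ^ 2 * B (k + 1) ≤ B 1 / ((k : ℝ) + 1) := by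
  have hβpos := beta_pos_of_tau_pos hβ0 hβ (tau_pos hτ0 hτ)
  have hB1 := (estimate_pos hB hL (hβpos 1)).1
  induction k with
  | zero => simp [hτ0]
  | succ k ih =>
    rw [weight_succ hτ0 hβ0 hβ hB hL hτ]
    obtain ⟨h1, h2⟩ := tau_mem hτ0 hβ0 hβ hB hL hτ (k + 1)
    push_cast at h1 ⊢
    calc (1 - τ (k + 1)) * (τ k ^ 2 * B (k + 1))
        ≤ (1 - τ (k + 1)) * (B 1 / ((k : ℝ) + 1)) := by
          have : 0 ≤ 1 - τ (k + 1) := by linarith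
          gcongr
      _ ≤ (1 - 1 / ((k : ℝ) + 1 + 1)) * (B 1 / ((k : ℝ) + 1)) := by gcongr
      _ = B 1 / ((k : ℝ) + 1 + 1) := by field_simp; ring

end Parameters

/-! ### Rates for the basic method and for old gradients. -/

section Rates

variable {H G : Type*} [NormedAddCommGroup H] [InnerProductSpace ℝ H] [CompleteSpace H]
  [NormedAddCommGroup G] [InnerProductSpace ℝ G] [CompleteSpace G]
  {P : Problem H G} {S : G →L[ℝ] G} {ydot : G} {τ β B : ℕ → ℝ}
  {xbar xtilde xhat : ℕ → H} {y : ℕ → G} {xstar : H}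

theorem IsLinearized.rate (hS : IsPositiveDefinite S) (hL : 0 < P.Lf ∨ P.M ≠ 0)
    (hx : xstar ∈ P.minimizers) (h : IsLinearized P S ydot τ β B xbar xtilde xhat y) (k : ℕ) :
    P.smoothF S ydot (β (k + 1)) (xbar (k + 1)) - P.optVal ≤
      ((B 1 / (2 * ((k : ℝ) + 1)) * ‖xstar - xtilde 0‖ ^ 2 : ℝ) : EReal) := by
  have hL' : 0 < P.Lf ∨ 0 < P.normM S ^ 2 := hL.imp_right (P.normM_pos hS)
  have hτpos := tau_pos h.tau_zero h.tau_succ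
  have hβpos := beta_pos_of_tau_pos h.beta_zero h.beta_succ hτpos
  have hBpos := fun k => (estimate_pos h.B_succ hL' (hβpos (k + 1))).1
  have hmem := tau_mem h.tau_zero h.beta_zero h.beta_succ h.B_succ hL' h.tau_succ
  refine Problem.smoothF_sub_optVal_le hx fun hfin gs hs hgs hhs => ?_
  have hmain := accelerated_recursion (Ψ := fun k => P.smoothF S ydot (β k) (xbar k)) (τ := τ)
    (c := fun k => τ k ^ 2 * B (k + 1)) (D := fun k => ‖xstar - xtilde k‖ ^ 2) (ε := fun _ => 0)
    (Fs := P.f xstar + gs + hs) h.tau_zero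
    (fun k => mul_pos (pow_pos (hτpos k) 2) (hBpos k))
    (weight_succ h.tau_zero h.beta_zero h.beta_succ h.B_succ hL' h.tau_succ)
    (fun k Φ hΦ => by
      obtain ⟨q, hq⟩ := (h.dual k).exists_conjugate_eq P.h_proper hfin
      have hβk : β k = β (k + 1) * (1 + τ k) := by
        have := hτpos k
        rw [h.beta_succ]; field_simp
      refine P.descent_step hS (hβpos (k + 1)) (hτpos k) (hmem k).2 (hBpos k) hq (h.hat k)
        (h.tilde_succ k) (h.bar_succ k) hgs hhs (fun x => ?_) (by rwa [← hβk])
      rw [h.B_succ]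
      exact P.smooth_upper_bound hS (hβpos (k + 1)) hq (h.dual k) (by simp) x) k
  refine hmain.trans (EReal.coe_le_coe_iff.2 ?_)
  have hw := weight_le h.tau_zero h.beta_zero h.beta_succ h.B_succ hL' h.tau_succ k
  have hc : 0 ≤ τ k ^ 2 * B (k + 1) := (mul_pos (pow_pos (hτpos k) 2) (hBpos k)).le
  simp only [zero_div, Finset.sum_const_zero, mul_zero, add_zero]
  have h1 := mul_le_mul_of_nonneg_right hw (sq_nonneg ‖xstar - xtilde 0‖)
  have h2 := mul_nonneg hc (sq_nonneg ‖xstar - xtilde (k + 1)‖)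
  have h3 : B 1 / (2 * ((k : ℝ) + 1)) = B 1 / ((k : ℝ) + 1) / 2 := by field_simp
  rw [h3]
  linarith

theorem IsOldGradient.rate (hS : IsPositiveDefinite S) (hL : 0 < P.Lf) {σ δ : ℝ} (hσ : 0 < σ)
    (hδ : 0 < δ) {xold xtrial : ℕ → H} (hx : xstar ∈ P.minimizers)
    (h : IsOldGradient P S ydot σ δ τ β B xbar xtilde xhat xold xtrial y) (k : ℕ) :
    P.smoothF S ydot (β (k + 1)) (xbar (k + 1)) - P.optVal ≤
      ((B 1 / ((k : ℝ) + 1) * (1 / 2 * ‖xstar - xtilde 0‖ ^ 2 + σ * (B 1 / P.Lf) ^ (1 + δ) *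
        ∑' i : ℕ, 1 / ((i : ℝ) + 1) ^ (1 + δ)) : ℝ) : EReal) := by
  have hL' : 0 < P.Lf ∨ 0 < P.normM S ^ 2 := Or.inl hL
  have hτpos := tau_pos h.tau_zero h.tau_succ
  have hβpos := beta_pos_of_tau_pos h.beta_zero h.beta_succ hτpos
  have hBpos := fun k => (estimate_pos h.B_succ hL' (hβpos (k + 1))).1
  have hmem := tau_mem h.tau_zero h.beta_zero h.beta_succ h.B_succ hL' h.tau_succ
  have hcpos : ∀ k, 0 < τ k ^ 2 * B (k + 1) := fun k => mul_pos (pow_pos (hτpos k) 2) (hBpos k)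
  have hw := weight_le h.tau_zero h.beta_zero h.beta_succ h.B_succ hL' h.tau_succ
  refine Problem.smoothF_sub_optVal_le hx fun hfin gs hs hgs hhs => ?_
  have hmain := accelerated_recursion (Ψ := fun k => P.smoothF S ydot (β k) (xbar k)) (τ := τ)
    (c := fun k => τ k ^ 2 * B (k + 1)) (D := fun k => ‖xstar - xtilde k‖ ^ 2)
    (ε := fun k => P.Lf * (σ * (τ k ^ 2 * B (k + 1) / P.Lf) ^ (2 + δ)))
    (Fs := P.f xstar + gs + hs) h.tau_zero hcpos
    (weight_succ h.tau_zero h.beta_zero h.beta_succ h.B_succ hL' h.tau_succ)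
    (fun k Φ hΦ => by
      obtain ⟨q, hq⟩ := (h.dual k).exists_conjugate_eq P.h_proper hfin
      have hβk : β k = β (k + 1) * (1 + τ k) := by
        have := hτpos k
        rw [h.beta_succ]; field_simp
      rw [hβk] at hΦ
      by_cases htest : P.OldGradientTest σ δ (τ k) (B (k + 1)) (xhat k) (xold k)
        ((1 - τ k) • xbar k + τ k • xtrial k)
      · have htilde := (h.accept k htest).2
        have hstep := h.trial k
        rw [← htilde] at hstep htest
        rw [← h.bar_succ] at htest
        refine P.descent_step hS (hβpos (k + 1)) (hτpos k) (hmem k).2 (hBpos k) hq (h.hat k)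
          hstep (h.bar_succ k) hgs hhs (fun x => ?_) hΦ
        have := mul_le_mul_of_nonneg_left htest hL.le
        have hup := P.smooth_upper_bound hS (hβpos (k + 1)) hq (h.dual k) (x' := xbar (k + 1))
          (r := xold k) (ε := P.Lf * (σ * (τ k ^ 2 * B (k + 1) / P.Lf) ^ (2 + δ)))
          (by linarith) x
        rwa [← h.B_succ] at hup
      -- After a rejection the gradient is taken at `xhat k`, so the true error is `0`, below the
      -- allowed `ε k`.
      · refine P.descent_step hS (hβpos (k + 1)) (hτpos k) (hmem k).2 (hBpos k) hq (h.hat k)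
          (h.reject k htest).2 (h.bar_succ k) hgs hhs (fun x => ?_) hΦ
        have hup := P.smooth_upper_bound hS (hβpos (k + 1)) hq (h.dual k) (x' := xbar (k + 1))
          (r := xhat k) (ε := P.Lf * (σ * (τ k ^ 2 * B (k + 1) / P.Lf) ^ (2 + δ)))
          (by
            rw [sub_self]
            have := div_pos (hcpos k) hL
            positivity) x
        rwa [← h.B_succ] at hup) k
  refine hmain.trans (EReal.coe_le_coe_iff.2 ?_)
  have hB1 := hBpos 0
  -- Dividing by the weight lowers the exponent to `1 + δ`; as the weight is `O(1/(i+1))`, the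
  -- errors are summable.
  have hterm : ∀ i : ℕ, P.Lf * (σ * (τ i ^ 2 * B (i + 1) / P.Lf) ^ (2 + δ)) /
      (τ i ^ 2 * B (i + 1)) ≤ σ * (B 1 / P.Lf) ^ (1 + δ) * (1 / ((i : ℝ) + 1) ^ (1 + δ)) := by
    intro i
    have hi := hcpos i
    have hwi := hw i
    generalize τ i ^ 2 * B (i + 1) = c at hi hwi
    have hcL : 0 < c / P.Lf := by positivity
    have h1 : P.Lf * (σ * (c / P.Lf) ^ (2 + δ)) / c = σ * (c / P.Lf) ^ (1 + δ) := by
      rw [show 2 + δ = 1 + (1 + δ) by ring, Real.rpow_add hcL 1 (1 + δ), Real.rpow_one]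
      field_simp
    have h2 : (B 1 / P.Lf) ^ (1 + δ) * (1 / ((i : ℝ) + 1) ^ (1 + δ)) =
        (B 1 / ((i : ℝ) + 1) / P.Lf) ^ (1 + δ) := by
      rw [mul_one_div, ← Real.div_rpow (by positivity) (by positivity), div_right_comm]
    rw [h1, mul_assoc, h2]
    gcongr
  have hsummable : Summable fun i : ℕ => 1 / ((i : ℝ) + 1) ^ (1 + δ) := by
    have := (summable_nat_add_iff 1).2
      (Real.summable_one_div_nat_rpow.2 (show 1 < 1 + δ by linarith))
    simpa using this
  have hsum : ∑ i ∈ Finset.range (k + 1), P.Lf * (σ * (τ i ^ 2 * B (i + 1) / P.Lf) ^ (2 + δ)) /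
      (τ i ^ 2 * B (i + 1)) ≤
      σ * (B 1 / P.Lf) ^ (1 + δ) * ∑' i : ℕ, 1 / ((i : ℝ) + 1) ^ (1 + δ) := by
    refine (Finset.sum_le_sum fun i _ => hterm i).trans ?_
    rw [← Finset.mul_sum]
    have := hsummable.sum_le_tsum (Finset.range (k + 1)) (fun i _ => by positivity)
    gcongr
  have hZ : 0 ≤ σ * (B 1 / P.Lf) ^ (1 + δ) * ∑' i : ℕ, 1 / ((i : ℝ) + 1) ^ (1 + δ) := by
    have : 0 ≤ ∑' i : ℕ, 1 / ((i : ℝ) + 1) ^ (1 + δ) := tsum_nonneg fun i => by positivity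
    positivity
  have h1 := mul_le_mul_of_nonneg_left hsum (hcpos k).le
  have h2 := mul_le_mul_of_nonneg_right (hw k)
    (add_nonneg (show 0 ≤ 1 / 2 * ‖xstar - xtilde 0‖ ^ 2 by positivity) hZ)
  have h3 := mul_nonneg (hcpos k).le (sq_nonneg ‖xstar - xtilde (k + 1)‖)
  linarith

end Rates

end Asgard

namespace Asgard

namespace IsLineSearch

variable {H G : Type*} [NormedAddCommGroup H] [InnerProductSpace ℝ H] [CompleteSpace H]
  [NormedAddCommGroup G] [InnerProductSpace ℝ G] [CompleteSpace G]
  {P : Problem H G} {S : G →L[ℝ] G} {ydot : G} {a : ℝ} {τ β B : ℕ → ℝ}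
  {xbar xtilde xhat : ℕ → H} {y : ℕ → G} {xstar : H}

/-! ### Parameters of the line search. -/

section Parameters

variable (h : IsLineSearch P S ydot a τ β B xbar xtilde xhat y)

include h

theorem estimate_pos (k : ℕ) : 0 < B k := by
  have ha := zero_lt_one.trans h.one_lt_a
  induction k with
  | zero => exact h.B_zero_pos
  | succ k ih =>
    obtain ⟨n, hn, -⟩ := h.step k
    rw [hn]
    positivity

theorem estimate_le_succ (k : ℕ) : B k ≤ B (k + 1) := by
  obtain ⟨n, hn, -⟩ := h.step k
  rw [hn]
  exact le_mul_of_one_le_left (h.estimate_pos k).le (one_le_pow₀ h.one_lt_a.le)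

theorem tau_rule (k : ℕ) : lineSearchTau τ B k (B (k + 1)) (τ k) := by
  obtain ⟨n, -, -, hc, -⟩ := h.step k
  exact hc.tau

theorem tau_zero : τ 0 = 1 := h.tau_rule 0

theorem beta_succ (k : ℕ) : β (k + 1) = β k / (1 + τ k) := by
  obtain ⟨n, -, -, hc, -⟩ := h.step k
  exact hc.beta

theorem tau_pos (k : ℕ) : 0 < τ k := by
  cases k with
  | zero => rw [h.tau_zero]; exact one_pos
  | succ k => exact (h.tau_rule (k + 1)).1

theorem beta_pos (k : ℕ) : 0 < β k :=
  beta_pos_of_tau_pos h.beta_zero h.beta_succ h.tau_pos k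

theorem weight_pos (k : ℕ) : 0 < τ k ^ 2 * B (k + 1) :=
  mul_pos (pow_pos (h.tau_pos k) 2) (h.estimate_pos (k + 1))

theorem lineSearchTau_le_one {k : ℕ} {b t : ℝ} (hb : 0 < b) (ht : lineSearchTau τ B k b t) :
    0 < t ∧ t ≤ 1 := by
  cases k with
  | zero =>
    have : t = 1 := ht
    rw [this]
    exact ⟨one_pos, le_rfl⟩
  | succ k =>
    obtain ⟨h0, h1⟩ := ht
    refine ⟨h0, ?_⟩
    have h2 : 0 < (1 - t) / (t ^ 2 * b) := by
      rw [h1]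
      exact one_div_pos.2 (h.weight_pos k)
    have h3 := (div_pos_iff_of_pos_right (by positivity)).1 h2
    linarith

theorem tau_le_one (k : ℕ) : τ k ≤ 1 :=
  (h.lineSearchTau_le_one (h.estimate_pos (k + 1)) (h.tau_rule k)).2

theorem weight_succ (k : ℕ) :
    τ (k + 1) ^ 2 * B (k + 1 + 1) = (1 - τ (k + 1)) * (τ k ^ 2 * B (k + 1)) := by
  have h1 := (h.tau_rule (k + 1)).2
  rw [div_eq_div_iff (h.weight_pos (k + 1)).ne' (h.weight_pos k).ne', one_mul] at h1
  exact h1.symm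

theorem beta_eq (k : ℕ) : β k = β (k + 1) * (1 + τ k) := by
  have := h.tau_pos k
  rw [h.beta_succ]
  field_simp

theorem beta_succ_le (k : ℕ) : β (k + 1) ≤ β k := by
  have h1 := h.beta_eq k
  have h2 := mul_pos (h.beta_pos (k + 1)) (h.tau_pos k)
  linarith

theorem beta_le_zero (k : ℕ) : β k ≤ β 0 := by
  induction k with
  | zero => exact le_rfl
  | succ k ih => exact (h.beta_succ_le k).trans ih

/-- The line search does not increase the estimate much beyond the global bound. -/
theorem estimate_le (hS : IsPositiveDefinite S) (k : ℕ) :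
    B k ≤ a * (P.Lf + 2 * P.normM S ^ 2 / β k) := by
  have ha := zero_lt_one.trans h.one_lt_a
  induction k with
  | zero =>
    refine h.B_zero_le.trans ?_
    have h0 := h.beta_zero
    gcongr
    linarith [sq_nonneg (P.normM S)]
  | succ k ih =>
    have hmono : a * (P.Lf + 2 * P.normM S ^ 2 / β k) ≤
        a * (P.Lf + 2 * P.normM S ^ 2 / β (k + 1)) := by
      have h1 := h.beta_succ_le k
      have h2 := h.beta_pos (k + 1)
      gcongr
    refine le_trans ?_ hmono
    obtain ⟨n, hn, hfail, -⟩ := h.step k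
    cases n with
    | zero =>
      rw [hn, pow_zero, one_mul]
      exact ih
    | succ m =>
      -- The last rejected trial has estimate `B (k+1) / a`. Its own smoothing parameter is `β k /
      -- (1 + t.τ) ≥ β k / 2`, whence the factor `2`.
      obtain ⟨t, htB, hcomp, hnot⟩ := hfail m m.lt_succ_self
      have hBk := h.estimate_pos k
      have htpos : 0 < t.B := by rw [htB]; positivity
      obtain ⟨hτ0, hτ1⟩ := h.lineSearchTau_le_one htpos hcomp.tau
      have hβk := h.beta_pos k
      have htβ : 0 < t.β := by rw [hcomp.beta]; positivity
      have hlt : t.B < P.Lf + P.normM S ^ 2 / t.β := by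
        by_contra! hge
        exact hnot (Trial.passes_of_le hS htβ hcomp.dual hge)
      have hle : P.normM S ^ 2 / t.β ≤ 2 * P.normM S ^ 2 / β k := by
        rw [hcomp.beta, div_div_eq_mul_div]
        have := sq_nonneg (P.normM S)
        exact div_le_div_of_nonneg_right (by nlinarith) hβk.le
      rw [hn, pow_succ', mul_assoc, ← htB]
      exact mul_le_mul_of_nonneg_left (by linarith) ha.le

/-- The ratio of the two sides equals `1` at `k = 0`, where `β 1 = β 0 / 2`, and each iteration
multiplies it by `1 - τ² ≤ 1`. -/
theorem weight_le (k : ℕ) : τ k ^ 2 * B (k + 1) ≤ 2 * B 1 * β (k + 1) / β 0 := by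
  have h0 := h.beta_zero
  rw [le_div_iff₀ h0]
  induction k with
  | zero =>
    have h1 := h.beta_eq 0
    rw [h.tau_zero] at h1 ⊢
    rw [h1]
    linarith
  | succ k ih =>
    rw [h.weight_succ]
    have h1 := h.beta_eq (k + 1)
    have h2 := h.tau_pos (k + 1)
    have h3 := h.tau_le_one (k + 1)
    have h4 := h.beta_pos (k + 1 + 1)
    have h5 := h.estimate_pos 1
    rw [h1] at ih
    have h6 := mul_le_mul_of_nonneg_left ih (sub_nonneg.2 h3)
    have h7 : 0 ≤ 2 * B 1 * β (k + 1 + 1) * τ (k + 1) ^ 2 := by positivity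
    linarith

/-- Monotone estimates give `s² ≤ (1 - s) t²` for successive parameters `t`, `s`. With `m = k + 2`,
failure of the bound means `s m > 2 - s`, so `(2 - s)² ≤ 4 (1 - s)`, impossible for `s > 0`. -/
theorem tau_le (k : ℕ) : τ k * ((k : ℝ) + 2) ≤ 2 := by
  induction k with
  | zero => simp [h.tau_zero]
  | succ k ih =>
    have hs := h.tau_pos (k + 1)
    have ht := h.tau_pos k
    have hs1 := h.tau_le_one (k + 1)
    have h1 : τ (k + 1) ^ 2 ≤ (1 - τ (k + 1)) * τ k ^ 2 := by
      have h2 := h.weight_succ k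
      have h3 := h.estimate_pos (k + 1 + 1)
      have h4 := mul_le_mul_of_nonneg_left (h.estimate_le_succ (k + 1))
        (mul_nonneg (sub_nonneg.2 hs1) (sq_nonneg (τ k)))
      refine le_of_mul_le_mul_right ?_ h3
      linarith
    generalize τ (k + 1) = s at *
    generalize τ k = t at *
    push_cast
    by_contra! hlt
    obtain ⟨m, hm⟩ : ∃ m : ℝ, (k : ℝ) + 2 = m := ⟨_, rfl⟩
    have hm0 : 0 ≤ m := by rw [← hm]; positivity
    rw [show (k : ℝ) + 1 + 2 = m + 1 by linarith] at hlt
    rw [hm] at ih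
    have h5 : (t * m) ^ 2 ≤ 2 ^ 2 := pow_le_pow_left₀ (by positivity) ih 2
    have h6 : (2 - s) ^ 2 ≤ (s * m) ^ 2 := pow_le_pow_left₀ (by linarith) (by linarith) 2
    have h7 := mul_le_mul_of_nonneg_right h1 (sq_nonneg m)
    have h8 := mul_le_mul_of_nonneg_left h5 (sub_nonneg.2 hs1)
    nlinarith

/-- Converse to `weight_le`: by `tau_le` the ratio is at least the product of `1 - 4/(i+2)² =
i(i+4)/(i+2)²` over `1 ≤ i ≤ k`, which telescopes to the stated fraction. -/
theorem le_weight (k : ℕ) :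
    2 * B 1 * β (k + 1) / β 0 * ((((k : ℝ) + 3) * (k + 4)) / (6 * (k + 1) * (k + 2))) ≤
      τ k ^ 2 * B (k + 1) := by
  have h0 := h.beta_zero
  induction k with
  | zero =>
    have h1 := h.beta_eq 0
    have h2 := h.beta_pos 1
    rw [h.tau_zero] at h1 ⊢
    rw [zero_add, h1]
    refine le_of_eq ?_
    field_simp
    ring
  | succ k ih =>
    rw [h.weight_succ]
    have h1 := h.beta_eq (k + 1)
    have h2 := h.tau_pos (k + 1)
    have h3 := h.tau_le_one (k + 1)
    have h4 := h.beta_pos (k + 1 + 1)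
    have h5 := h.estimate_pos 1
    have h6 := h.tau_le (k + 1)
    push_cast at h6 ⊢
    have h7 : ((k : ℝ) + 1) * (k + 5) / (k + 3) ^ 2 ≤ 1 - τ (k + 1) ^ 2 := by
      rw [div_le_iff₀ (by positivity)]
      have := pow_le_pow_left₀ (by positivity) h6 2
      nlinarith
    rw [h1] at ih
    refine le_trans ?_ (mul_le_mul_of_nonneg_left ih (sub_nonneg.2 h3))
    have e1 : (1 - τ (k + 1)) * (2 * B 1 * (β (k + 1 + 1) * (1 + τ (k + 1))) / β 0 *
        ((((k : ℝ) + 3) * (k + 4)) / (6 * (k + 1) * (k + 2)))) =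
        (1 - τ (k + 1) ^ 2) * (2 * B 1 * β (k + 1 + 1) / β 0 *
        ((((k : ℝ) + 3) * (k + 4)) / (6 * (k + 1) * (k + 2)))) := by
      ring
    rw [e1]
    refine le_trans (le_of_eq ?_) (mul_le_mul_of_nonneg_right h7 (by positivity))
    field_simp
    ring

/-- The right side must not contain `B 1`, which varies with the run. The products `B k * β k` stay
below `D`, so `le_weight` gives `κ * β (k + 1) ≤ τ k`, and `1 / β` grows by at least `κ / 2` per
iteration. -/
theorem beta_rate (hS : IsPositiveDefinite S) (k : ℕ) :
    B 1 * β (k + 1) / β 0 ≤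
      6 * (a * (P.Lf * β 0 + 2 * P.normM S ^ 2)) / β 0 / ((k : ℝ) + 1) := by
  have ha := zero_lt_one.trans h.one_lt_a
  have h0 := h.beta_zero
  have hB1 := h.estimate_pos 1
  set D := a * (P.Lf * β 0 + 2 * P.normM S ^ 2) with hD
  have hBD : ∀ k, B k * β k ≤ D := by
    intro k
    have h1 := h.beta_pos k
    have h2 := mul_le_mul_of_nonneg_right (h.estimate_le hS k) h1.le
    have h3 : a * (P.Lf + 2 * P.normM S ^ 2 / β k) * β k =
        a * (P.Lf * β k + 2 * P.normM S ^ 2) := by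
      field_simp
    rw [h3] at h2
    refine h2.trans ?_
    have h4 := h.beta_le_zero k
    have h5 := P.Lf_nonneg
    rw [hD]
    gcongr
  have hDpos : 0 < D := (mul_pos hB1 (h.beta_pos 1)).trans_le (hBD 1)
  set κ := Real.sqrt (B 1 / (3 * β 0 * D)) with hκ
  have hκ2 : κ ^ 2 = B 1 / (3 * β 0 * D) := Real.sq_sqrt (by positivity)
  have hκpos : 0 < κ := Real.sqrt_pos.2 (by positivity)
  have hκτ : ∀ k, κ * β (k + 1) ≤ τ k := by
    intro k
    have hβ := h.beta_pos (k + 1)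
    refine le_of_sq_le_sq ?_ (h.tau_pos k).le
    rw [mul_pow, hκ2, div_mul_eq_mul_div, div_le_iff₀ (by positivity)]
    -- The fraction decreases to `1/6`, the source of the `3` in `κ`.
    have h1 : (1 : ℝ) / 6 ≤ (((k : ℝ) + 3) * (k + 4)) / (6 * (k + 1) * (k + 2)) := by
      rw [div_le_div_iff₀ (by positivity) (by positivity)]
      nlinarith [(k.cast_nonneg : (0 : ℝ) ≤ k)]
    have h2 := (mul_le_mul_of_nonneg_left h1
      (show 0 ≤ 2 * B 1 * β (k + 1) / β 0 by positivity)).trans (h.le_weight k)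
    have h3 := mul_le_mul_of_nonneg_left (hBD (k + 1)) (sq_nonneg (τ k))
    have h4 := mul_le_mul_of_nonneg_right h2 (show 0 ≤ 3 * β 0 * β (k + 1) by positivity)
    have e1 : 2 * B 1 * β (k + 1) / β 0 * (1 / 6) * (3 * β 0 * β (k + 1)) =
        B 1 * β (k + 1) ^ 2 := by
      field_simp
      norm_num
    rw [e1] at h4
    have h5 := mul_le_mul_of_nonneg_left h3 (show 0 ≤ 3 * β 0 by positivity)
    linarith
  have hinv : ∀ k : ℕ, κ / 2 * k ≤ 1 / β k := by
    intro k
    induction k with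
    | zero =>
      simp only [Nat.cast_zero, mul_zero]
      positivity
    | succ k ih =>
      have hβ := h.beta_pos k
      have hβ' := h.beta_pos (k + 1)
      have h1 : 1 / β (k + 1) = 1 / β k + τ k / β k := by
        rw [h.beta_succ, one_div_div, add_div]
      have h2 : κ / 2 ≤ τ k / β k := by
        rw [le_div_iff₀ hβ]
        have h3 := h.beta_eq k
        have h4 := mul_le_mul_of_nonneg_left (h.tau_le_one k) (mul_pos hκpos hβ').le
        have h5 := hκτ k
        rw [h3]
        linarith
      rw [h1]
      push_cast
      linarith
  -- This removes `κ`, and with it `B 1`, from the final constant; it uses `β 0 = 2 * β 1`.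
  have hκβ : κ * β 0 ≤ 1 := by
    refine le_of_sq_le_sq ?_ zero_le_one
    rw [mul_pow, hκ2, div_mul_eq_mul_div, div_le_iff₀ (by positivity)]
    have h1 := hBD 1
    have h2 := h.beta_eq 0
    rw [h.tau_zero, zero_add] at h2
    have h3 := mul_le_mul_of_nonneg_right h1 h0.le
    have h4 : B 1 * β 0 ^ 2 = 2 * (B 1 * β 1 * β 0) := by
      rw [pow_two]
      nth_rewrite 1 [h2]
      ring
    have h5 := mul_pos hDpos h0
    linarith
  have hfin : κ * (((k : ℝ) + 1) * β (k + 1)) ≤ 2 := by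
    have h1 := hinv (k + 1)
    rw [le_div_iff₀ (h.beta_pos (k + 1))] at h1
    push_cast at h1
    linarith
  have hB1' : B 1 = 3 * β 0 * D * κ ^ 2 := by
    rw [hκ2]
    field_simp
  rw [div_div, div_le_div_iff₀ h0 (by positivity)]
  have h6 : B 1 * (((k : ℝ) + 1) * β (k + 1)) ≤ 6 * D := by
    have h7 := mul_le_mul_of_nonneg_left hfin (show 0 ≤ 3 * β 0 * D * κ by positivity)
    have h8 := mul_le_mul_of_nonneg_left hκβ (show 0 ≤ 6 * D by positivity)
    rw [hB1']
    linarith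
  have h9 := mul_le_mul_of_nonneg_right h6 h0.le
  linarith

end Parameters

theorem rate (hS : IsPositiveDefinite S) (hx : xstar ∈ P.minimizers)
    (h : IsLineSearch P S ydot a τ β B xbar xtilde xhat y) (k : ℕ) :
    P.smoothF S ydot (β (k + 1)) (xbar (k + 1)) - P.optVal ≤
      ((B 1 * β (k + 1) / β 0 * ‖xstar - xtilde 0‖ ^ 2 : ℝ) : EReal) := by
  refine Problem.smoothF_sub_optVal_le hx fun hfin gs hs hgs hhs => ?_
  have hmain := accelerated_recursion (Ψ := fun k => P.smoothF S ydot (β k) (xbar k)) (τ := τ)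
    (c := fun k => τ k ^ 2 * B (k + 1)) (D := fun k => ‖xstar - xtilde k‖ ^ 2) (ε := fun _ => 0)
    (Fs := P.f xstar + gs + hs) h.tau_zero h.weight_pos h.weight_succ
    (fun k Φ hΦ => by
      obtain ⟨n, -, -, hc, hpass⟩ := h.step k
      obtain ⟨q, hq⟩ := hc.dual.exists_conjugate_eq P.h_proper hfin
      exact P.descent_step hS (h.beta_pos (k + 1)) (h.tau_pos k) (h.tau_le_one k)
        (h.estimate_pos (k + 1)) hq hc.hat hc.tilde hc.bar hgs hhs
        (fun x => hpass.upper_bound hS (h.beta_pos (k + 1)) hq hc.dual x)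
        (by rwa [← h.beta_eq k])) k
  refine hmain.trans (EReal.coe_le_coe_iff.2 ?_)
  simp only [zero_div, Finset.sum_const_zero, mul_zero, add_zero]
  have h1 := mul_le_mul_of_nonneg_right (h.weight_le k) (sq_nonneg ‖xstar - xtilde 0‖)
  have h2 := mul_nonneg (h.weight_pos k).le (sq_nonneg ‖xstar - xtilde (k + 1)‖)
  have h3 : 2 * B 1 * β (k + 1) / β 0 = 2 * (B 1 * β (k + 1) / β 0) := by ring
  rw [h3] at h1
  linarith

end IsLineSearch

end Asgard

theorem proposition1 {H G : Type*}
    [NormedAddCommGroup H] [InnerProductSpace ℝ H] [CompleteSpace H]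
    [NormedAddCommGroup G] [InnerProductSpace ℝ G] [CompleteSpace G]
    (P : Asgard.Problem H G) (S : G →L[ℝ] G) (hS : Asgard.IsPositiveDefinite S) (ydot : G) :
    -- linearized ASGARD
    ((0 < P.Lf ∨ P.M ≠ 0) →
      ∀ (τ β B : ℕ → ℝ) (xbar xtilde xhat : ℕ → H) (y : ℕ → G),
        Asgard.IsLinearized P S ydot τ β B xbar xtilde xhat y →
        ∀ xstar ∈ P.minimizers, ∀ k : ℕ,
          P.smoothF S ydot (β (k + 1)) (xbar (k + 1)) - P.optVal ≤
            ((B 1 / (2 * ((k : ℝ) + 1)) * ‖xstar - xtilde 0‖ ^ 2 : ℝ) : EReal)) ∧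
    -- linearized ASGARD with old gradients
    (0 < P.Lf →
      ∀ (σ δ : ℝ), 0 < σ → 0 < δ →
      ∀ (τ β B : ℕ → ℝ) (xbar xtilde xhat xold xtrial : ℕ → H) (y : ℕ → G),
        Asgard.IsOldGradient P S ydot σ δ τ β B xbar xtilde xhat xold xtrial y →
        ∀ xstar ∈ P.minimizers, ∀ k : ℕ,
          P.smoothF S ydot (β (k + 1)) (xbar (k + 1)) - P.optVal ≤
            ((B 1 / ((k : ℝ) + 1) *
              (1 / 2 * ‖xstar - xtilde 0‖ ^ 2 +
                σ * (B 1 / P.Lf) ^ (1 + δ) *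
                  ∑' i : ℕ, 1 / ((i : ℝ) + 1) ^ (1 + δ)) : ℝ) : EReal)) ∧
    -- linearized ASGARD with line search
    (∀ (a β₀ : ℝ), ∃ C : ℝ,
      ∀ (τ β B : ℕ → ℝ) (xbar xtilde xhat : ℕ → H) (y : ℕ → G),
        Asgard.IsLineSearch P S ydot a τ β B xbar xtilde xhat y → β 0 = β₀ →
        ∀ xstar ∈ P.minimizers, ∀ k : ℕ,
          P.smoothF S ydot (β (k + 1)) (xbar (k + 1)) - P.optVal ≤
            ((B 1 * β (k + 1) / β 0 * ‖xstar - xtilde 0‖ ^ 2 : ℝ) : EReal) ∧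
          B 1 * β (k + 1) / β 0 * ‖xstar - xtilde 0‖ ^ 2 ≤
            C * ‖xstar - xtilde 0‖ ^ 2 / ((k : ℝ) + 1)) := by
  refine ⟨fun hL τ β B xbar xtilde xhat y h xstar hx k => h.rate hS hL hx k,
    fun hL σ δ hσ hδ τ β B xbar xtilde xhat xold xtrial y h xstar hx k =>
      h.rate hS hL hσ hδ hx k, fun a β₀ => ?_⟩
  refine ⟨6 * (a * (P.Lf * β₀ + 2 * P.normM S ^ 2)) / β₀,
    fun τ β B xbar xtilde xhat y h hβ₀ xstar hx k => ⟨h.rate hS hx k, ?_⟩⟩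
  have h1 := mul_le_mul_of_nonneg_right (h.beta_rate hS k) (sq_nonneg ‖xstar - xtilde 0‖)
  rw [hβ₀] at h1 ⊢
  rwa [div_mul_eq_mul_div (6 * (a * (P.Lf * β₀ + 2 * P.normM S ^ 2)) / β₀)] at h1
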